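/- Let $R=\mathbb{C}[x_0,\dots,x_n]$ with its usual grading, and let $f\in R$ be a homogeneous polynomial of degree $d$ which is reduced (nonzero and without multiple factors), with associated hypersurface $V(f)\subset\mathbb{P}^n$. For an integer $0\le k\le d$ let $J^k(f)\subset R$ be the homogeneous ideal generated by all the $k$-th order partial derivatives of $f$, and let $M^k(f)=R/J^k(f)$ be the $k$-th order Milnor algebra of $f$. (1) The algebra $M^k(f)$ is Artinian if and only if the multiplicity of $V(f)$ at every point $p\in V(f)$ is at most $k$. Here the multiplicity of $V(f)$ at $p$ is the order of vanishing at $p$ of a local equation of $V(f)$. (2) Suppose that $k\ge 1$ and that $V(f)$ has only isolated singularities, i.e. its singular locus is a finite (possibly empty) set of pairwise distinct points $p_1,\dots,p_s$. Then the $k$-th order Tjurina numbers $\tau^k(V(f),p_i)$ are finite, and there is an $m_0$ such that for all $m\ge m_0$ $$\dim_{\mathbb{C}} M^k(f)_m=\sum_{i=1}^s\tau^k(V(f),p_i).$$ Here, if $g\in\mathcal{O}_n=\mathbb{C}\{y_1,\dots,y_n\}$ is a local equation of $V(f)$ at $p$, in affine coordinates $y_1,\dots,y_n$ centred at $p$,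 then $\tau^k(V(f),p)=\dim_{\mathbb{C}}\mathcal{O}_n/TI^k(g)$, where $TI^k(g)$ is the ideal of $\mathcal{O}_n$ generated by all the partial derivatives $\partial^\alpha g$ with $0\le|\alpha|\le k$. -/

import Mathlib

open scoped LinearAlgebra.Projectivization

noncomputable section

namespace HigherMilnor

/-! ### Higher order Jacobian ideals and Milnor algebras -/

/-- The ideal `J^k(f)` generated by all the partial derivatives of `f` of order exactly `k`.
A list `[i₁, …, iₖ]` of indices encodes the operator `∂_{i₁} ⋯ ∂_{iₖ}`. -/
def jacobianIdeal {n : ℕ} (k : ℕ) (f : MvPolynomial (Fin (n + 1)) ℂ) :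
    Ideal (MvPolynomial (Fin (n + 1)) ℂ) :=
  Ideal.span {h | ∃ l : List (Fin (n + 1)), l.length = k ∧
    h = l.foldr (fun i g => MvPolynomial.pderiv i g) f}

/-- The `k`-th order Milnor algebra `M^k(f) = R / J^k(f)`. -/
abbrev MilnorAlgebra {n : ℕ} (k : ℕ) (f : MvPolynomial (Fin (n + 1)) ℂ) : Type :=
  MvPolynomial (Fin (n + 1)) ℂ ⧸ jacobianIdeal k f

/-- The graded piece `M^k(f)_m`: the image in `M^k(f)` of the forms of degree `m`. -/
def milnorPiece {n : ℕ} (k : ℕ) (f : MvPolynomial (Fin (n + 1)) ℂ) (m : ℕ) :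
    Submodule ℂ (MilnorAlgebra k f) :=
  (MvPolynomial.homogeneousSubmodule (Fin (n + 1)) ℂ m).map
    (Ideal.Quotient.mkₐ ℂ (jacobianIdeal k f)).toLinearMap

/-! ### The projective hypersurface and its singular points -/

/-- The complex projective space `ℙⁿ`. -/
abbrev ProjSpace (n : ℕ) : Type := ℙ ℂ (Fin (n + 1) → ℂ)

/-- The set of points of the hypersurface `V(f)`, for `f` homogeneous. -/
def hypersurface {n : ℕ} (f : MvPolynomial (Fin (n + 1)) ℂ) : Set (ProjSpace n) :=
  {p | MvPolynomial.eval p.rep f = 0}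

/-- The singular points of the hypersurface `V(f)`, for `f` homogeneous: the points of `V(f)` at
which all the first order partial derivatives of `f` vanish. -/
def singularLocus {n : ℕ} (f : MvPolynomial (Fin (n + 1)) ℂ) : Set (ProjSpace n) :=
  {p | p ∈ hypersurface f ∧
    ∀ i, MvPolynomial.eval p.rep (MvPolynomial.pderiv i f) = 0}

theorem exists_rep_ne_zero {n : ℕ} (p : ProjSpace n) : ∃ i, p.rep i ≠ 0 :=
  Function.ne_iff.mp p.rep_nonzero

/-- An index `i` such that the point `p` lies in the affine chart `x_i ≠ 0`. -/
def chartIndex {n : ℕ} (p : ProjSpace n) : Fin (n + 1) :=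
  (exists_rep_ne_zero p).choose

theorem rep_chartIndex_ne_zero {n : ℕ} (p : ProjSpace n) : p.rep (chartIndex p) ≠ 0 :=
  (exists_rep_ne_zero p).choose_spec

/-- The local equation of `V(f)` at `p`: in the affine chart `x_i = 1` around `p`, with the affine
coordinates `y` translated so that `p` is the origin, it is
`g(y) = f(a₀ + y₀, …, 1, …, a_{n-1} + y_{n-1})`, where `1` stands in position `i` and `a` are the
affine coordinates of `p`. -/
def localEquation {n : ℕ} (f : MvPolynomial (Fin (n + 1)) ℂ) (p : ProjSpace n) :
    MvPolynomial (Fin n) ℂ :=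
  MvPolynomial.aeval
    ((chartIndex p).insertNth (α := fun _ => MvPolynomial (Fin n) ℂ) 1 fun j : Fin n =>
      MvPolynomial.C (p.rep ((chartIndex p).succAbove j) / p.rep (chartIndex p)) +
        MvPolynomial.X j) f

/-! ### The local ring of germs of holomorphic functions at the origin of `ℂⁿ` -/

/-- A formal power series in `n` variables over `ℂ` converges in a neighbourhood of the origin iff
its coefficients grow at most geometrically in the total degree. -/
def IsConvergent {n : ℕ} (g : MvPowerSeries (Fin n) ℂ) : Prop :=
  ∃ C K : ℝ, 0 < C ∧ 0 < K ∧ ∀ α : Fin n →₀ ℕ, ‖MvPowerSeries.coeff α g‖ ≤ C * K ^ α.degree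

theorem isConvergent_coe {n : ℕ} (g : MvPolynomial (Fin n) ℂ) :
    IsConvergent (g : MvPowerSeries (Fin n) ℂ) := by
  have h0 : 0 ≤ ∑ β ∈ g.support, ‖g.coeff β‖ := Finset.sum_nonneg fun _ _ => norm_nonneg _
  refine ⟨∑ β ∈ g.support, ‖g.coeff β‖ + 1, 1, by linarith, one_pos, fun α => ?_⟩
  rw [MvPolynomial.coeff_coe, one_pow, mul_one]
  by_cases h : α ∈ g.support
  · have := Finset.single_le_sum (f := fun β => ‖g.coeff β‖) (fun _ _ => norm_nonneg _) h
    linarith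
  · rw [MvPolynomial.notMem_support_iff.mp h, norm_zero]
    linarith

theorem IsConvergent.add {n : ℕ} {g h : MvPowerSeries (Fin n) ℂ} (hg : IsConvergent g)
    (hh : IsConvergent h) : IsConvergent (g + h) := by
  obtain ⟨C, K, hC, hK, H⟩ := hg
  obtain ⟨C', K', hC', hK', H'⟩ := hh
  refine ⟨C + C', max K K', by positivity, by positivity, fun α => ?_⟩
  rw [map_add, add_mul]
  refine (norm_add_le _ _).trans (add_le_add ((H α).trans ?_) ((H' α).trans ?_))
  · gcongr
    exact le_max_left _ _
  · gcongr
    exact le_max_right _ _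

theorem card_antidiagonal_le {n : ℕ} (α : Fin n →₀ ℕ) :
    (Finset.HasAntidiagonal.antidiagonal α).card ≤ 2 ^ α.degree := by
  have h1 : (Finset.HasAntidiagonal.antidiagonal α).card ≤ (Finset.Iic α).card := by
    refine Finset.card_le_card_of_injOn Prod.fst (fun x hx => ?_) (fun x hx y hy hxy => ?_)
    · have := Finset.HasAntidiagonal.mem_antidiagonal.mp hx
      simp [← this]
    · have hx' := Finset.HasAntidiagonal.mem_antidiagonal.mp hx
      have hy' := Finset.HasAntidiagonal.mem_antidiagonal.mp hy
      refine Prod.ext hxy (add_left_cancel (a := x.1) ?_)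
      rw [hx', hxy, hy']
  refine h1.trans ?_
  rw [Finsupp.card_Iic, Finsupp.degree_apply, ← Finset.prod_pow_eq_pow_sum]
  refine Finset.prod_le_prod' fun i _ => ?_
  rw [Nat.card_Iic]
  exact Nat.lt_two_pow_self

theorem IsConvergent.mul {n : ℕ} {g h : MvPowerSeries (Fin n) ℂ} (hg : IsConvergent g)
    (hh : IsConvergent h) : IsConvergent (g * h) := by
  obtain ⟨C, K, hC, hK, H⟩ := hg
  obtain ⟨C', K', hC', hK', H'⟩ := hh
  refine ⟨C * C', 2 * max K K', by positivity, by positivity, fun α => ?_⟩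
  rw [MvPowerSeries.coeff_mul]
  have key : ∀ x ∈ Finset.HasAntidiagonal.antidiagonal α,
      ‖MvPowerSeries.coeff x.1 g * MvPowerSeries.coeff x.2 h‖ ≤
        C * C' * (max K K') ^ α.degree := by
    intro x hx
    rw [norm_mul, ← Finset.HasAntidiagonal.mem_antidiagonal.mp hx, map_add, pow_add]
    calc _ ≤ (C * K ^ x.1.degree) * (C' * K' ^ x.2.degree) := by
            gcongr
            · exact H _
            · exact H' _
      _ ≤ (C * (max K K') ^ x.1.degree) * (C' * (max K K') ^ x.2.degree) := by
            gcongr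
            · exact le_max_left _ _
            · exact le_max_right _ _
      _ = _ := by ring
  refine (norm_sum_le_of_le _ key).trans ?_
  rw [Finset.sum_const, nsmul_eq_mul, mul_pow]
  have hc : ((Finset.HasAntidiagonal.antidiagonal α).card : ℝ) ≤ 2 ^ α.degree := by
    exact_mod_cast card_antidiagonal_le α
  calc _ ≤ (2 : ℝ) ^ α.degree * (C * C' * (max K K') ^ α.degree) := by gcongr
    _ = _ := by ring

theorem IsConvergent.pderiv {n : ℕ} {g : MvPowerSeries (Fin n) ℂ} (hg : IsConvergent g)
    (i : Fin n) : IsConvergent (MvPowerSeries.pderiv ℂ i g) := by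
  obtain ⟨C, K, hC, hK, H⟩ := hg
  refine ⟨C * K, 2 * K, by positivity, by positivity, fun α => ?_⟩
  rw [MvPowerSeries.coeff_pderiv, norm_mul]
  have h1 : ‖((α i : ℂ) + 1)‖ ≤ 2 ^ α.degree := by
    have h2 : α i + 1 ≤ 2 ^ α.degree :=
      (Nat.lt_two_pow_self (n := α i)).trans_le
        (Nat.pow_le_pow_right two_pos (Finsupp.le_degree i α))
    have h3 : ((α i : ℂ) + 1) = ((α i + 1 : ℕ) : ℂ) := by push_cast; rfl
    rw [h3, Complex.norm_natCast]
    exact_mod_cast h2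
  calc _ ≤ (C * K ^ (α + Finsupp.single i 1).degree) * 2 ^ α.degree := by
          gcongr
          exact H _
    _ = _ := by
          rw [map_add, Finsupp.degree_single, pow_add, mul_pow]
          ring

/-- The local ring `𝒪ₙ` of germs of holomorphic functions at the origin of `ℂⁿ`, as the ring
`ℂ{y₁, …, yₙ}` of convergent power series. -/
def convergentPowerSeries (n : ℕ) : Subalgebra ℂ (MvPowerSeries (Fin n) ℂ) where
  carrier := {g | IsConvergent g}
  mul_mem' := IsConvergent.mul
  add_mem' := IsConvergent.add
  algebraMap_mem' c := by
    have h := isConvergent_coe (MvPolynomial.C c : MvPolynomial (Fin n) ℂ)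
    rwa [MvPolynomial.coe_C] at h

/-- The partial derivative `∂/∂y_i` on `𝒪ₙ`. -/
def germPderiv {n : ℕ} (i : Fin n) (g : convergentPowerSeries n) : convergentPowerSeries n :=
  ⟨MvPowerSeries.pderiv ℂ i g, IsConvergent.pderiv g.2 i⟩

/-! ### Higher order Tjurina algebras -/

/-- The `k`-th order Tjurina ideal of `g ∈ 𝒪ₙ`, generated by all the partial derivatives of `g` of
order at most `k` (including `g` itself). -/
def tjurinaIdeal {n : ℕ} (k : ℕ) (g : convergentPowerSeries n) :
    Ideal (convergentPowerSeries n) :=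
  Ideal.span {h | ∃ l : List (Fin n), l.length ≤ k ∧ h = l.foldr germPderiv g}

/-- The `k`-th order Tjurina algebra of the germ `g = 0`. -/
abbrev TjurinaAlgebra {n : ℕ} (k : ℕ) (g : convergentPowerSeries n) : Type :=
  convergentPowerSeries n ⧸ tjurinaIdeal k g

/-- The germ at the origin of `ℂⁿ` of the local equation of `V(f)` at `p`. -/
def localGerm {n : ℕ} (f : MvPolynomial (Fin (n + 1)) ℂ) (p : ProjSpace n) :
    convergentPowerSeries n :=
  ⟨(localEquation f p : MvPowerSeries (Fin n) ℂ), isConvergent_coe _⟩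

/-- The multiplicity of the hypersurface `V(f)` at `p`: the lowest degree of a monomial occurring
in the local equation of `V(f)` at `p`. -/
def hypersurfaceMultiplicity {n : ℕ} (f : MvPolynomial (Fin (n + 1)) ℂ) (p : ProjSpace n) : ℕ∞ :=
  MvPowerSeries.order (localGerm f p : MvPowerSeries (Fin n) ℂ)

/-- The `k`-th order Tjurina number `τ^k(V(f), p)`. -/
def tjurinaNumber {n : ℕ} (k : ℕ) (f : MvPolynomial (Fin (n + 1)) ℂ) (p : ProjSpace n) : ℕ :=
  Module.finrank ℂ (TjurinaAlgebra k (localGerm f p))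

end HigherMilnor

end

/-!
The common zeros of the `k`-th order partial derivatives of `f` are the points at which `V(f)` has
multiplicity larger than `k`: by Euler's identity, `J^k(f)` contains all the derivatives of order at
most `k`, and it becomes in an affine chart the ideal of all the derivatives of order at most `k` of
the local equation. By the Nullstellensatz, `M^k(f)` is therefore Artinian iff there is no such
point.

If there are finitely many such points, let `l` be a linear form vanishing at none of them. In large
degrees multiplication by `l` is bijective on `M^k(f)`, so `dim M^k(f)_m` is eventually equal to the
dimension of `M^k(f) / (l - 1)`. By the Chinese remainder theorem this Artinian algebra is the
product of its localizations at the points. Replacing `l` by a coordinate does not change the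
dimension of such a local factor, which then becomes the Tjurina algebra: modulo a power of the
maximal ideal, convergent power series and polynomials are the same.
-/

noncomputable section

namespace HigherMilnor

open MvPolynomial

section GradedPieces

attribute [local instance] MvPolynomial.gradedAlgebra

/-- The image of the forms of degree `m` in the quotient of the polynomial ring by `I`. The ideal
`I` is arbitrary; for homogeneous `I` this is the graded piece of degree `m` of the quotient. -/
def gradedPiece {σ K : Type*} [CommRing K] (I : Ideal (MvPolynomial σ K)) (m : ℕ) :
    Submodule K (MvPolynomial σ K ⧸ I) :=
  (homogeneousSubmodule σ K m).map (Ideal.Quotient.mkₐ K I).toLinearMap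

theorem exists_forall_mem_of_pow_mul_mem {A : Type*} [CommRing A] [IsNoetherianRing A]
    {I H : Ideal A} {l : A} {N : ℕ} (h : I ^ N ≤ H ⊔ Ideal.span {l}) :
    ∃ M, ∀ x ∈ I ^ M, ∀ t, l ^ t * x ∈ H → x ∈ H := by
  let C : Ideal A := Submodule.comap (LinearMap.mulLeft A l) H
  have pow_mul_le : I ^ N * C ≤ H := by
    refine Ideal.mul_le.mpr fun y hy x hx => ?_
    obtain ⟨u, hu, v, hv, rfl⟩ := Submodule.mem_sup.mp (h hy)
    obtain ⟨b, rfl⟩ := Ideal.mem_span_singleton.mp hv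
    rw [add_mul, mul_right_comm]
    exact add_mem (Ideal.mul_mem_right _ _ hu) (Ideal.mul_mem_right _ _ hx)
  obtain ⟨k, hk⟩ := Ideal.exists_pow_inf_eq_pow_smul I C
  have artin_rees : I ^ (k + N) ⊓ C ≤ H := by
    have h_smul := hk (k + N) (Nat.le_add_right k N)
    simp only [smul_eq_mul, Ideal.mul_top, Nat.add_sub_cancel_left] at h_smul
    rw [h_smul]
    exact (Ideal.mul_mono_right inf_le_right).trans pow_mul_le
  refine ⟨k + N, fun x hx t => ?_⟩
  induction t with
  | zero => simp
  | succ t ih =>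
    intro hlx
    rw [pow_succ', mul_assoc] at hlx
    exact ih (artin_rees ⟨Ideal.mul_mem_left _ _ hx, hlx⟩)

variable {σ K : Type*} [CommRing K] {H : Ideal (MvPolynomial σ K)} {l : MvPolynomial σ K} {N m : ℕ}

theorem mem_pow_idealOfVars_of_isHomogeneous {F : MvPolynomial σ K} (hF : F.IsHomogeneous m)
    (hm : N ≤ m) : F ∈ idealOfVars σ K ^ N := by
  rw [mem_pow_idealOfVars_iff']
  exact fun x hx => hF.coeff_eq_zero (by lia)

theorem homogeneousComponent_add_mul_of_isHomogeneous {i : ℕ} (hl : l.IsHomogeneous i)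
    (b : MvPolynomial σ K) (j : ℕ) :
    homogeneousComponent (i + j) (l * b) = l * homogeneousComponent j b := by
  have h := DirectSum.coe_decompose_mul_add_of_left_mem (homogeneousSubmodule σ K) (j := j) (b := b)
    ((mem_homogeneousSubmodule i l).mpr hl)
  rwa [← decomposition.decompose'_apply, ← decomposition.decompose'_apply]

theorem monotone_gradedPiece {I : Ideal (MvPolynomial σ K)} (hl : l.IsHomogeneous 1)
    (hlI : l - 1 ∈ I) : Monotone (gradedPiece I) := by
  refine monotone_nat_of_le_succ fun i => ?_
  rintro - ⟨F, hF, rfl⟩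
  refine ⟨F * l, hF.mul hl, Ideal.Quotient.eq.mpr ?_⟩
  rw [← mul_sub_one]
  exact Ideal.mul_mem_left _ _ hlI

theorem gradedPiece_succ_le (hH : H.IsHomogeneous (homogeneousSubmodule σ K))
    (hl : l.IsHomogeneous 1) (h : idealOfVars σ K ^ N ≤ H ⊔ Ideal.span {l}) (hm : N ≤ m + 1) :
    gradedPiece (H ⊔ Ideal.span {l - 1}) (m + 1) ≤ gradedPiece (H ⊔ Ideal.span {l - 1}) m := by
  rintro - ⟨F, hF, rfl⟩
  obtain ⟨u, hu, v, hv, huv⟩ :=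
    Submodule.mem_sup.mp (h (mem_pow_idealOfVars_of_isHomogeneous hF hm))
  obtain ⟨b, rfl⟩ := Ideal.mem_span_singleton.mp hv
  have hF_eq : F = homogeneousComponent (m + 1) u + l * homogeneousComponent m b := by
    rw [← homogeneousComponent_add_mul_of_isHomogeneous hl, add_comm 1, ← map_add, huv,
      homogeneousComponent_eq_self hF]
  refine ⟨homogeneousComponent m b, homogeneousComponent_isHomogeneous m b, ?_⟩
  refine (Ideal.Quotient.eq.mpr ?_).symm
  rw [hF_eq, add_sub_assoc, ← sub_one_mul]
  exact add_mem (Ideal.mem_sup_left (homogeneousComponent_mem_of_mem hH hu _))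
    (Ideal.mem_sup_right (Ideal.mul_mem_right _ _ (Ideal.mem_span_singleton_self _)))

theorem gradedPiece_eq_top (hH : H.IsHomogeneous (homogeneousSubmodule σ K))
    (hl : l.IsHomogeneous 1) (h : idealOfVars σ K ^ N ≤ H ⊔ Ideal.span {l}) (hm : N ≤ m) :
    gradedPiece (H ⊔ Ideal.span {l - 1}) m = ⊤ := by
  set I := H ⊔ Ideal.span {l - 1}
  have mono : Monotone (gradedPiece I) :=
    monotone_gradedPiece hl (Ideal.mem_sup_right (Ideal.mem_span_singleton_self _))
  have le_of_le (i : ℕ) (hi : m ≤ i) : gradedPiece I i ≤ gradedPiece I m := by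
    induction i, hi using Nat.le_induction with
    | base => exact le_rfl
    | succ i hi ih => exact (gradedPiece_succ_le hH hl h (by lia)).trans ih
  have le_piece (i : ℕ) : gradedPiece I i ≤ gradedPiece I m :=
    (le_total i m).elim (fun hi => mono hi) (le_of_le i)
  rw [eq_top_iff]
  rintro x -
  obtain ⟨F, rfl⟩ := Ideal.Quotient.mk_surjective x
  rw [← sum_homogeneousComponent F, map_sum]
  exact sum_mem fun i _ => le_piece i ⟨_, homogeneousComponent_isHomogeneous i F, rfl⟩

theorem finite_quotient_sup_span_sub_one [Finite σ]
    (hH : H.IsHomogeneous (homogeneousSubmodule σ K)) (hl : l.IsHomogeneous 1)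
    (h : idealOfVars σ K ^ N ≤ H ⊔ Ideal.span {l}) :
    Module.Finite K (MvPolynomial σ K ⧸ H ⊔ Ideal.span {l - 1}) :=
  Module.finite_def.mpr
    (gradedPiece_eq_top hH hl h le_rfl ▸ (homogeneousSubmodule_fg σ K N).map _)

theorem homogeneousComponent_add_sum_mem (hH : H.IsHomogeneous (homogeneousSubmodule σ K))
    (hl : l.IsHomogeneous 1) {F b : MvPolynomial σ K} (hFb : F - (l - 1) * b ∈ H) (j : ℕ) :
    homogeneousComponent j b +
      ∑ i ∈ Finset.range (j + 1), l ^ (j - i) * homogeneousComponent i F ∈ H := by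
  have component_mem (i : ℕ) : homogeneousComponent i F - homogeneousComponent i (l * b) +
      homogeneousComponent i b ∈ H := by
    rw [← map_sub, ← map_add, sub_add, ← sub_one_mul]
    exact homogeneousComponent_mem_of_mem hH hFb i
  induction j with
  | zero =>
    have l_mul_b : homogeneousComponent 0 (l * b) = 0 := by
      rw [homogeneousComponent_zero, ← constantCoeff_eq, map_mul, constantCoeff_eq,
        hl.coeff_eq_zero (by simp), zero_mul, C_0]
    simpa [l_mul_b, add_comm] using component_mem 0
  | succ j ih =>
    have pow_succ_sub : ∑ i ∈ Finset.range (j + 1), l ^ (j + 1 - i) * homogeneousComponent i F =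
        l * ∑ i ∈ Finset.range (j + 1), l ^ (j - i) * homogeneousComponent i F := by
      rw [Finset.mul_sum]
      refine Finset.sum_congr rfl fun i hi => ?_
      rw [Nat.sub_add_comm (Finset.mem_range_succ_iff.mp hi), pow_succ', mul_assoc]
    have h := add_mem (component_mem (j + 1)) (Ideal.mul_mem_left H l ih)
    rw [add_comm j 1, homogeneousComponent_add_mul_of_isHomogeneous hl, add_comm 1 j] at h
    rw [Finset.sum_range_succ, pow_succ_sub, Nat.sub_self, pow_zero, one_mul]
    convert h using 1
    ring

theorem exists_pow_mul_mem_of_mem_sup_span_sub_one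
    (hH : H.IsHomogeneous (homogeneousSubmodule σ K)) (hl : l.IsHomogeneous 1)
    {F : MvPolynomial σ K} (hF : F.IsHomogeneous m) (hFI : F ∈ H ⊔ Ideal.span {l - 1}) :
    ∃ t, l ^ t * F ∈ H := by
  obtain ⟨u, hu, v, hv, huv⟩ := Submodule.mem_sup.mp hFI
  obtain ⟨b, rfl⟩ := Ideal.mem_span_singleton.mp hv
  refine ⟨b.totalDegree + 1, ?_⟩
  have h := homogeneousComponent_add_sum_mem hH hl (F := F) (b := b)
    (by rwa [← huv, add_sub_cancel_right]) (m + (b.totalDegree + 1))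
  rw [homogeneousComponent_eq_zero _ _ (by lia), zero_add,
    Finset.sum_eq_single_of_mem m (Finset.mem_range.mpr (by lia)) fun i _ hi => by
      rw [homogeneousComponent_of_mem ((mem_homogeneousSubmodule _ _).mpr hF), if_neg hi, mul_zero],
    Nat.add_sub_cancel_left, homogeneousComponent_eq_self hF] at h
  exact h

theorem eventually_finrank_gradedPiece_eq [Finite σ] [IsNoetherianRing K]
    (hH : H.IsHomogeneous (homogeneousSubmodule σ K)) (hl : l.IsHomogeneous 1)
    (h : idealOfVars σ K ^ N ≤ H ⊔ Ideal.span {l}) :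
    ∀ᶠ m in Filter.atTop, Module.finrank K (gradedPiece H m) =
      Module.finrank K (MvPolynomial σ K ⧸ H ⊔ Ideal.span {l - 1}) := by
  obtain ⟨M, hM⟩ := exists_forall_mem_of_pow_mul_mem h
  filter_upwards [Filter.eventually_ge_atTop M, Filter.eventually_ge_atTop N] with m hMm hNm
  let φ : (MvPolynomial σ K ⧸ H) →ₗ[K] MvPolynomial σ K ⧸ H ⊔ Ideal.span {l - 1} :=
    (Ideal.Quotient.factorₐ K le_sup_left).toLinearMap
  refine (LinearEquiv.ofBijective (φ.domRestrict (gradedPiece H m)) ⟨?_, ?_⟩).finrank_eq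
  · refine (injective_iff_map_eq_zero _).mpr ?_
    rintro ⟨-, F, hF, rfl⟩ hF0
    obtain ⟨t, ht⟩ :=
      exists_pow_mul_mem_of_mem_sup_span_sub_one hH hl hF (Ideal.Quotient.eq_zero_iff_mem.mp hF0)
    exact Subtype.ext (Ideal.Quotient.eq_zero_iff_mem.mpr
      (hM F (mem_pow_idealOfVars_of_isHomogeneous hF hMm) t ht))
  · intro y
    obtain ⟨F, hF, rfl⟩ : y ∈ gradedPiece (H ⊔ Ideal.span {l - 1}) m :=
      gradedPiece_eq_top hH hl h hNm ▸ Submodule.mem_top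
    exact ⟨⟨_, F, hF, rfl⟩, rfl⟩

end GradedPieces

section ZeroLoci

variable {σ K : Type*} [Field K]

theorem mem_zeroLocus_iff_eval {I : Ideal (MvPolynomial σ K)} {v : σ → K} :
    v ∈ zeroLocus K I ↔ ∀ F ∈ I, eval v F = 0 :=
  Iff.rfl

theorem mem_zeroLocus_span_iff {s : Set (MvPolynomial σ K)} {v : σ → K} :
    v ∈ zeroLocus K (Ideal.span s) ↔ ∀ F ∈ s, eval v F = 0 := by
  rw [zeroLocus_span]
  rfl

theorem exists_pow_le_of_zeroLocus_subset [IsAlgClosed K] [Finite σ]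
    {I J : Ideal (MvPolynomial σ K)} (h : zeroLocus K I ⊆ zeroLocus K J) : ∃ N, J ^ N ≤ I := by
  refine Ideal.exists_pow_le_of_le_radical_of_fg ?_ (IsNoetherian.noetherian J)
  rw [← vanishingIdeal_zeroLocus_eq_radical (K := K) I]
  exact le_zeroLocus_iff_le_vanishingIdeal.mp h

theorem eq_top_of_zeroLocus_eq_empty [IsAlgClosed K] [Finite σ] {I : Ideal (MvPolynomial σ K)}
    (h : zeroLocus K I = ∅) : I = ⊤ := by
  obtain ⟨N, hN⟩ := exists_pow_le_of_zeroLocus_subset (I := I) (J := ⊤) (by simp [h])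
  rwa [Ideal.top_pow, top_le_iff] at hN

theorem exists_pow_idealOfVars_le [IsAlgClosed K] [Finite σ] {I : Ideal (MvPolynomial σ K)}
    (h : zeroLocus K I ⊆ {0}) : ∃ N, idealOfVars σ K ^ N ≤ I := by
  refine exists_pow_le_of_zeroLocus_subset (h.trans ?_)
  rintro - rfl
  rw [idealOfVars, mem_zeroLocus_span_iff]
  simp

end ZeroLoci

section LinearForms

theorem eval_smul_of_isHomogeneous {σ K : Type*} [CommSemiring K] {F : MvPolynomial σ K} {m : ℕ}
    (hF : F.IsHomogeneous m) (c : K) (v : σ → K) : eval (c • v) F = c ^ m * eval v F := by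
  rw [eval_eq, eval_eq, Finset.mul_sum]
  refine Finset.sum_congr rfl fun x hx => ?_
  simp only [Pi.smul_apply, smul_eq_mul, mul_pow, Finset.prod_mul_distrib]
  rw [Finset.prod_pow_eq_pow_sum, ← hF.degree_eq_sum_deg_support hx, mul_left_comm]

variable {σ K : Type*} [Field K]

theorem exists_linear_form_forall_eval_ne_zero [Infinite K] [Finite σ] {ι : Type*} [Finite ι]
    (a : ι → σ → K) (ha : ∀ i, a i ≠ 0) :
    ∃ l : MvPolynomial σ K, l.IsHomogeneous 1 ∧ ∀ i, eval (a i) l ≠ 0 := by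
  cases nonempty_fintype ι
  cases nonempty_fintype σ
  classical
  have prod_ne_zero : ∏ i, ∑ j, C (a i j) * (X j : MvPolynomial σ K) ≠ 0 := by
    refine Finset.prod_ne_zero_iff.mpr fun i _ h0 => ?_
    obtain ⟨j, hj⟩ := Function.ne_iff.mp (ha i)
    have eval_single := congrArg (eval (Pi.single j (1 : K))) h0
    exact hj (by simpa [Pi.single_apply] using eval_single)
  obtain ⟨w, hw⟩ : ∃ w, eval w (∏ i, ∑ j, C (a i j) * (X j : MvPolynomial σ K)) ≠ 0 := by
    by_contra! h0
    exact prod_ne_zero (MvPolynomial.funext fun w => by rw [h0 w, map_zero])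
  refine ⟨∑ j, C (w j) * X j, IsHomogeneous.sum _ _ _ fun j _ => isHomogeneous_C_mul_X _ _,
    fun i => ?_⟩
  rw [map_prod] at hw
  simpa [mul_comm] using Finset.prod_ne_zero_iff.mp hw i (Finset.mem_univ i)

/-- The homogeneous ideal of the point of projective space represented by `a`, generated by the
linear forms that vanish at `a`. -/
def pointIdeal {σ K : Type*} [CommRing K] (a : σ → K) : Ideal (MvPolynomial σ K) :=
  Ideal.span {F | F.IsHomogeneous 1 ∧ eval a F = 0}

attribute [local instance] MvPolynomial.gradedAlgebra in
theorem isHomogeneous_pointIdeal_pow (a : σ → K) (N : ℕ) :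
    (pointIdeal a ^ N).IsHomogeneous (homogeneousSubmodule σ K) := by
  have base : (pointIdeal a).IsHomogeneous (homogeneousSubmodule σ K) :=
    Ideal.homogeneous_span _ _ fun _ hF => ⟨1, hF.1⟩
  induction N with
  | zero => rw [pow_zero, Ideal.one_eq_top]; exact Ideal.IsHomogeneous.top _
  | succ N ih => rw [pow_succ]; exact ih.mul base

theorem zeroLocus_pointIdeal_pow_subset (a : σ → K) (N : ℕ) :
    zeroLocus K (pointIdeal a ^ N) ⊆ (K ∙ a) := by
  intro v hv
  have eval_eq_zero {F : MvPolynomial σ K} (hF : F.IsHomogeneous 1) (haF : eval a F = 0) :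
      eval v F = 0 := by
    have hF_mem : F ∈ pointIdeal a := Ideal.subset_span ⟨hF, haF⟩
    have h := mem_zeroLocus_iff_eval.mp hv _ (Ideal.pow_mem_pow hF_mem N)
    exact eq_zero_of_pow_eq_zero (map_pow (eval v) F N ▸ h)
  rcases eq_or_ne a 0 with rfl | ha
  · have v_eq_zero : v = 0 := funext fun j => by
      simpa using eval_eq_zero (isHomogeneous_X K j) (by simp)
    simp [v_eq_zero]
  obtain ⟨i, hi⟩ := Function.ne_iff.mp ha
  have minor_eq_zero (j : σ) : a i * v j - a j * v i = 0 := by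
    simpa using eval_eq_zero (F := C (a i) * X j - C (a j) * X i)
      ((isHomogeneous_C_mul_X _ _).sub (isHomogeneous_C_mul_X _ _)) (by simp [mul_comm])
  refine Submodule.mem_span_singleton.mpr ⟨v i / a i, funext fun j => ?_⟩
  rw [Pi.zero_apply] at hi
  rw [Pi.smul_apply, smul_eq_mul]
  field_simp
  linear_combination -minor_eq_zero j

theorem span_singleton_subset_zeroLocus_pointIdeal (a : σ → K) :
    ((K ∙ a : Submodule K (σ → K)) : Set (σ → K)) ⊆ zeroLocus K (pointIdeal a) := by
  intro v hv
  obtain ⟨c, rfl⟩ := Submodule.mem_span_singleton.mp hv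
  rw [pointIdeal, mem_zeroLocus_span_iff]
  rintro F ⟨hF, haF⟩
  rw [eval_smul_of_isHomogeneous hF, haF, mul_zero]

end LinearForms

section ChineseRemainder

variable {ι K R : Type*} [CommRing R]

theorem iInf_sup_eq_of_prod_le [Fintype ι] {Q : Ideal R} {A : ι → Ideal R}
    (hco : Pairwise fun i j => IsCoprime (Q ⊔ A i) (Q ⊔ A j)) (hprod : ∏ i, A i ≤ Q) :
    ⨅ i, (Q ⊔ A i) = Q := by
  have prod_sup_le (s : Finset ι) : ∏ i ∈ s, (Q ⊔ A i) ≤ Q ⊔ ∏ i ∈ s, A i := by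
    classical
    induction s using Finset.induction_on with
    | empty => simp
    | insert i s hi ih =>
      rw [Finset.prod_insert hi, Finset.prod_insert hi]
      refine (Ideal.mul_mono_right ih).trans ?_
      rw [Ideal.sup_mul, Ideal.mul_sup (A i)]
      exact sup_le (Ideal.mul_le_left.trans le_sup_left)
        (sup_le (Ideal.mul_le_right.trans le_sup_left) le_sup_right)
  refine le_antisymm ?_ (le_iInf fun i => le_sup_left)
  rw [← Finset.inf_univ_eq_iInf, Finset.inf_eq_iInf,
    ← Ideal.prod_eq_iInf_of_pairwise_isCoprime fun i _ j _ hij => hco hij]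
  exact (prod_sup_le _).trans (sup_le le_rfl hprod)

theorem finrank_quotient_iInf_eq_sum [Field K] [Algebra K R] [Fintype ι] {I : ι → Ideal R}
    (hco : Pairwise fun i j => IsCoprime (I i) (I j)) (hfin : ∀ i, Module.Finite K (R ⧸ I i)) :
    Module.finrank K (R ⧸ ⨅ i, I i) = ∑ i, Module.finrank K (R ⧸ I i) := by
  rw [← Module.finrank_pi_fintype]
  refine (AlgEquiv.ofRingEquiv (f := Ideal.quotientInfRingEquivPiQuotient I hco)
    fun c => rfl).toLinearEquiv.finrank_eq

theorem finrank_quotient_eq_sum_of_prod_le [Field K] [Algebra K R] [Fintype ι] {Q : Ideal R}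
    {A : ι → Ideal R} (hco : Pairwise fun i j => IsCoprime (Q ⊔ A i) (Q ⊔ A j))
    (hprod : ∏ i, A i ≤ Q) (hfin : ∀ i, Module.Finite K (R ⧸ Q ⊔ A i)) :
    Module.finrank K (R ⧸ Q) = ∑ i, Module.finrank K (R ⧸ Q ⊔ A i) := by
  conv_lhs => rw [← iInf_sup_eq_of_prod_le hco hprod]
  exact finrank_quotient_iInf_eq_sum hco hfin

end ChineseRemainder

section HilbertFunction

attribute [local instance] MvPolynomial.gradedAlgebra

variable {σ K : Type*} [Field K]

theorem eq_zero_of_mem_span_singleton_of_eval_eq_zero {a v : σ → K} {l : MvPolynomial σ K}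
    (hl : l.IsHomogeneous 1) (hal : eval a l ≠ 0) (hv : v ∈ K ∙ a) (hvl : eval v l = 0) :
    v = 0 := by
  obtain ⟨c, rfl⟩ := Submodule.mem_span_singleton.mp hv
  rw [eval_smul_of_isHomogeneous hl, pow_one] at hvl
  rw [(mul_eq_zero.mp hvl).resolve_right hal, zero_smul]

theorem eval_zero_linear_form {l : MvPolynomial σ K} (hl : l.IsHomogeneous 1) : eval 0 l = 0 := by
  rw [← zero_smul K (0 : σ → K), eval_smul_of_isHomogeneous hl, pow_one, zero_mul]

theorem ne_zero_of_mem_zeroLocus {Q : Ideal (MvPolynomial σ K)} {l : MvPolynomial σ K}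
    (hl : l.IsHomogeneous 1) (hlQ : l - 1 ∈ Q) {v : σ → K} (hv : v ∈ zeroLocus K Q) : v ≠ 0 := by
  rintro rfl
  have eval_l_sub_one := mem_zeroLocus_iff_eval.mp hv _ hlQ
  rw [map_sub, map_one, eval_zero_linear_form hl, zero_sub] at eval_l_sub_one
  exact neg_ne_zero.mpr one_ne_zero eval_l_sub_one

variable [IsAlgClosed K] [Finite σ]

theorem exists_pow_idealOfVars_le_sup_span {H : Ideal (MvPolynomial σ K)} {l : MvPolynomial σ K}
    (h : ∀ v ∈ zeroLocus K H, eval v l = 0 → v = 0) :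
    ∃ N, idealOfVars σ K ^ N ≤ H ⊔ Ideal.span {l} :=
  exists_pow_idealOfVars_le fun v hv =>
    h v (zeroLocus_anti_mono le_sup_left hv)
      (mem_zeroLocus_iff_eval.mp hv l (Ideal.mem_sup_right (Ideal.mem_span_singleton_self l)))

theorem exists_pow_idealOfVars_le_sup_pointIdeal_pow (J : Ideal (MvPolynomial σ K)) {a : σ → K}
    {l : MvPolynomial σ K} (hl : l.IsHomogeneous 1) (hal : eval a l ≠ 0) (N : ℕ) :
    ∃ M, idealOfVars σ K ^ M ≤ J ⊔ pointIdeal a ^ N ⊔ Ideal.span {l} :=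
  exists_pow_idealOfVars_le_sup_span fun _ hv =>
    eq_zero_of_mem_span_singleton_of_eval_eq_zero hl hal
      (zeroLocus_pointIdeal_pow_subset a N (zeroLocus_anti_mono le_sup_right hv))

theorem finite_quotient_sup_pointIdeal_pow {J : Ideal (MvPolynomial σ K)}
    (hJ : J.IsHomogeneous (homogeneousSubmodule σ K)) {a : σ → K} {l : MvPolynomial σ K}
    (hl : l.IsHomogeneous 1) (hal : eval a l ≠ 0) (N : ℕ) :
    Module.Finite K (MvPolynomial σ K ⧸ J ⊔ pointIdeal a ^ N ⊔ Ideal.span {l - 1}) :=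
  (exists_pow_idealOfVars_le_sup_pointIdeal_pow J hl hal N).elim fun _ =>
    finite_quotient_sup_span_sub_one (hJ.sup (isHomogeneous_pointIdeal_pow a N)) hl

theorem finrank_quotient_sup_pointIdeal_pow_congr {J : Ideal (MvPolynomial σ K)}
    (hJ : J.IsHomogeneous (homogeneousSubmodule σ K)) {a : σ → K} {l l' : MvPolynomial σ K}
    (hl : l.IsHomogeneous 1) (hal : eval a l ≠ 0) (hl' : l'.IsHomogeneous 1)
    (hal' : eval a l' ≠ 0) (N : ℕ) :
    Module.finrank K (MvPolynomial σ K ⧸ J ⊔ pointIdeal a ^ N ⊔ Ideal.span {l - 1}) =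
      Module.finrank K (MvPolynomial σ K ⧸ J ⊔ pointIdeal a ^ N ⊔ Ideal.span {l' - 1}) := by
  have hJN := hJ.sup (isHomogeneous_pointIdeal_pow a N)
  obtain ⟨M, hM⟩ := exists_pow_idealOfVars_le_sup_pointIdeal_pow J hl hal N
  obtain ⟨M', hM'⟩ := exists_pow_idealOfVars_le_sup_pointIdeal_pow J hl' hal' N
  obtain ⟨m, hm, hm'⟩ := ((eventually_finrank_gradedPiece_eq hJN hl hM).and
    (eventually_finrank_gradedPiece_eq hJN hl' hM')).exists
  rw [← hm, ← hm']

theorem isCoprime_sup_pointIdeal_pow {Q : Ideal (MvPolynomial σ K)} {l : MvPolynomial σ K}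
    (hl : l.IsHomogeneous 1) (hlQ : l - 1 ∈ Q) {a b : σ → K} (hab : b ∉ K ∙ a) (N : ℕ) :
    IsCoprime (Q ⊔ pointIdeal a ^ N) (Q ⊔ pointIdeal b ^ N) := by
  rw [Ideal.isCoprime_iff_sup_eq]
  refine eq_top_of_zeroLocus_eq_empty (Set.eq_empty_of_forall_notMem fun v hv => ?_)
  have hva : v ∈ K ∙ a := zeroLocus_pointIdeal_pow_subset a N
    (zeroLocus_anti_mono (le_sup_right.trans le_sup_left) hv)
  have hvb : v ∈ K ∙ b := zeroLocus_pointIdeal_pow_subset b N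
    (zeroLocus_anti_mono (le_sup_right.trans le_sup_right) hv)
  have hv0 : v ≠ 0 :=
    ne_zero_of_mem_zeroLocus hl hlQ (zeroLocus_anti_mono (le_sup_left.trans le_sup_left) hv)
  obtain ⟨c, rfl⟩ := Submodule.mem_span_singleton.mp hvb
  exact hab ((Submodule.smul_mem_iff _ (left_ne_zero_of_smul hv0)).mp hva)

theorem eventually_finrank_quotient_sup_span_eq_sum {J : Ideal (MvPolynomial σ K)}
    (hJ : J.IsHomogeneous (homogeneousSubmodule σ K)) {ι : Type*} [Fintype ι] {a : ι → σ → K}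
    (hpair : Pairwise fun i j => a j ∉ K ∙ a i)
    (hzero : ∀ v ∈ zeroLocus K J, v ≠ 0 → ∃ i, v ∈ K ∙ a i)
    {g : MvPolynomial σ K} (hg : g.IsHomogeneous 1) (hag : ∀ i, eval (a i) g ≠ 0) :
    ∀ᶠ N in Filter.atTop, Module.finrank K (MvPolynomial σ K ⧸ J ⊔ Ideal.span {g - 1}) =
      ∑ i, Module.finrank K
        (MvPolynomial σ K ⧸ J ⊔ pointIdeal (a i) ^ N ⊔ Ideal.span {g - 1}) := by
  have hgQ : g - 1 ∈ J ⊔ Ideal.span {g - 1} :=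
    Ideal.mem_sup_right (Ideal.mem_span_singleton_self _)
  obtain ⟨N₀, hN₀⟩ : ∃ N₀, (∏ i, pointIdeal (a i)) ^ N₀ ≤ J ⊔ Ideal.span {g - 1} :=
    exists_pow_le_of_zeroLocus_subset fun v hv => by
      obtain ⟨i, hi⟩ := hzero v (zeroLocus_anti_mono le_sup_left hv)
        (ne_zero_of_mem_zeroLocus hg hgQ hv)
      exact zeroLocus_anti_mono (Ideal.prod_le_inf.trans (Finset.inf_le (Finset.mem_univ i)))
        (span_singleton_subset_zeroLocus_pointIdeal _ hi)
  filter_upwards [Filter.eventually_ge_atTop N₀] with N hN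
  have hprod : ∏ i, pointIdeal (a i) ^ N ≤ J ⊔ Ideal.span {g - 1} := by
    rw [Finset.prod_pow]
    exact (Ideal.pow_le_pow_right hN).trans hN₀
  rw [finrank_quotient_eq_sum_of_prod_le
    (fun i j hij => isCoprime_sup_pointIdeal_pow hg hgQ (hpair hij) N) hprod fun i => by
      rw [sup_right_comm]; exact finite_quotient_sup_pointIdeal_pow hJ hg (hag i) N]
  exact Finset.sum_congr rfl fun i _ => by rw [sup_right_comm]

/-- The local contribution at each point may be computed in any affine chart `l = 1` containing it:
its dimension is an eventual value of a Hilbert function, which does not involve `l`. -/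
theorem eventually_finrank_gradedPiece_eq_sum {J : Ideal (MvPolynomial σ K)}
    (hJ : J.IsHomogeneous (homogeneousSubmodule σ K)) {ι : Type*} [Fintype ι] {a : ι → σ → K}
    (hpair : Pairwise fun i j => a j ∉ K ∙ a i)
    (hzero : ∀ v ∈ zeroLocus K J, v ≠ 0 → ∃ i, v ∈ K ∙ a i)
    {l : ι → MvPolynomial σ K} (hl : ∀ i, (l i).IsHomogeneous 1)
    (hal : ∀ i, eval (a i) (l i) ≠ 0) :
    ∀ᶠ N in Filter.atTop, ∀ᶠ m in Filter.atTop, Module.finrank K (gradedPiece J m) =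
      ∑ i, Module.finrank K
        (MvPolynomial σ K ⧸ J ⊔ pointIdeal (a i) ^ N ⊔ Ideal.span {l i - 1}) := by
  have : Infinite K := IsAlgClosed.instInfinite
  obtain ⟨g, hg, hag⟩ := exists_linear_form_forall_eval_ne_zero a fun i h0 =>
    hal i (h0 ▸ eval_zero_linear_form (hl i))
  obtain ⟨M, hM⟩ := exists_pow_idealOfVars_le_sup_span (H := J) (l := g) fun v hv hvg => by
    by_contra hv0
    obtain ⟨i, hi⟩ := hzero v hv hv0
    exact hv0 (eq_zero_of_mem_span_singleton_of_eval_eq_zero hg (hag i) hi hvg)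
  filter_upwards [eventually_finrank_quotient_sup_span_eq_sum hJ hpair hzero hg hag] with N hN
  filter_upwards [eventually_finrank_gradedPiece_eq hJ hg hM] with m hm
  rw [hm, hN]
  exact Finset.sum_congr rfl fun i _ =>
    finrank_quotient_sup_pointIdeal_pow_congr hJ hg (hag i) (hl i) (hal i) N

end HilbertFunction

section Derivatives

variable {σ R : Type*} [CommRing R] {F G : MvPolynomial σ R} {d k : ℕ}

/-- The iterated partial derivative `∂_{i₁} ⋯ ∂_{iᵣ} F` encoded by the list `[i₁, …, iᵣ]`. -/
def iteratedPderiv (L : List σ) (F : MvPolynomial σ R) : MvPolynomial σ R :=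
  L.foldr (fun i g => pderiv i g) F

/-- The ideal generated by the partial derivatives of `F` of order at most `k`, the polynomial
counterpart of the Tjurina ideal of a germ. -/
def derivativeIdeal (k : ℕ) (F : MvPolynomial σ R) : Ideal (MvPolynomial σ R) :=
  Ideal.span {H | ∃ L : List σ, L.length ≤ k ∧ H = iteratedPderiv L F}

theorem iteratedPderiv_mem_derivativeIdeal {L : List σ} (hL : L.length ≤ k) :
    iteratedPderiv L F ∈ derivativeIdeal k F :=
  Ideal.subset_span ⟨L, hL, rfl⟩

theorem derivativeIdeal_le_iff {I : Ideal (MvPolynomial σ R)} :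
    derivativeIdeal k F ≤ I ↔ ∀ L : List σ, L.length ≤ k → iteratedPderiv L F ∈ I := by
  rw [derivativeIdeal, Ideal.span_le]
  exact ⟨fun h L hL => h ⟨L, hL, rfl⟩, by rintro h _ ⟨L, hL, rfl⟩; exact h L hL⟩

theorem monotone_derivativeIdeal (F : MvPolynomial σ R) : Monotone (derivativeIdeal · F) :=
  fun _ _ h => derivativeIdeal_le_iff.mpr fun _ hL =>
    iteratedPderiv_mem_derivativeIdeal (hL.trans h)

theorem derivativeIdeal_zero_le_iff {I : Ideal (MvPolynomial σ R)} :
    derivativeIdeal 0 F ≤ I ↔ F ∈ I := by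
  simp [derivativeIdeal_le_iff, iteratedPderiv]

theorem derivativeIdeal_succ_le_iff {I : Ideal (MvPolynomial σ R)} :
    derivativeIdeal (k + 1) F ≤ I ↔ F ∈ I ∧ ∀ i, derivativeIdeal k (pderiv i F) ≤ I := by
  simp only [derivativeIdeal_le_iff]
  refine ⟨fun h => ⟨h [] (by simp), fun i L hL => ?_⟩, fun h L hL => ?_⟩
  · simpa [iteratedPderiv] using h (L ++ [i]) (by simpa using hL)
  · rcases L.eq_nil_or_concat with rfl | ⟨L, i, rfl⟩
    · exact h.1
    · simpa [iteratedPderiv] using h.2 i L (by simpa using hL)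

theorem pderiv_mem_derivativeIdeal (hG : G ∈ derivativeIdeal k F) (i : σ) :
    pderiv i G ∈ derivativeIdeal (k + 1) F := by
  induction hG using Submodule.span_induction with
  | mem x hx =>
    obtain ⟨L, hL, rfl⟩ := hx
    exact iteratedPderiv_mem_derivativeIdeal (L := i :: L) (by simpa using hL)
  | zero => simp
  | add x y _ _ hx hy => rw [map_add]; exact add_mem hx hy
  | smul a x hx ihx =>
    rw [smul_eq_mul, pderiv_mul]
    exact add_mem (Ideal.mul_mem_left _ _ (monotone_derivativeIdeal F k.le_succ hx))
      (Ideal.mul_mem_left _ _ ihx)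

theorem mem_idealOfVars_iff_eval : F ∈ idealOfVars σ R ↔ eval 0 F = 0 := by
  rw [← pow_one (idealOfVars σ R), mem_pow_idealOfVars_iff']
  simp [constantCoeff_eq, Finsupp.degree_eq_zero_iff]

theorem mem_pow_succ_idealOfVars_iff [CharZero R] [NoZeroDivisors R] {r : ℕ} :
    F ∈ idealOfVars σ R ^ (r + 1) ↔
      F ∈ idealOfVars σ R ∧ ∀ i, pderiv i F ∈ idealOfVars σ R ^ r := by
  classical
  refine ⟨fun hF => ⟨Ideal.pow_le_self r.succ_ne_zero hF, fun i => ?_⟩, fun ⟨hF, hFi⟩ => ?_⟩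
  · rw [mem_pow_idealOfVars_iff'] at hF ⊢
    intro α hα
    rw [coeff_pderiv, hF _ (by rwa [map_add, Finsupp.degree_single, Nat.add_lt_add_iff_right]),
      zero_mul]
  · simp only [mem_pow_idealOfVars_iff'] at hFi ⊢
    intro α hα
    by_cases h0 : α = 0
    · rw [h0, ← constantCoeff_eq, ← eval_zero]
      exact mem_idealOfVars_iff_eval.mp hF
    · obtain ⟨i, hi⟩ := Finsupp.ne_iff.mp h0
      obtain ⟨β, rfl⟩ : ∃ β, α = β + Finsupp.single i 1 :=
        ⟨α - Finsupp.single i 1, (tsub_add_cancel_of_le (by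
          simpa [Nat.one_le_iff_ne_zero] using hi)).symm⟩
      have coeff_eq_zero := hFi i β (by simpa using hα)
      rw [coeff_pderiv] at coeff_eq_zero
      exact (mul_eq_zero.mp coeff_eq_zero).resolve_right (Nat.cast_add_one_ne_zero _)

theorem derivativeIdeal_le_idealOfVars_iff [CharZero R] [NoZeroDivisors R] :
    derivativeIdeal k F ≤ idealOfVars σ R ↔ F ∈ idealOfVars σ R ^ (k + 1) := by
  induction k generalizing F with
  | zero => rw [derivativeIdeal_zero_le_iff, zero_add, pow_one]
  | succ k ih => simp only [derivativeIdeal_succ_le_iff, ih, ← mem_pow_succ_idealOfVars_iff]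

theorem isHomogeneous_iteratedPderiv (hF : F.IsHomogeneous d) (L : List σ) :
    (iteratedPderiv L F).IsHomogeneous (d - L.length) := by
  induction L with
  | nil => exact hF
  | cons i L ih =>
    rw [List.length_cons, ← Nat.sub_sub]
    exact ih.pderiv

end Derivatives

section EulerIdentity

variable {σ K : Type*} [Field K] [CharZero K] {F : MvPolynomial σ K} {d k : ℕ}

theorem mem_of_forall_pderiv_mem [Finite σ] (hF : F.IsHomogeneous d) (hd : d ≠ 0)
    {I : Ideal (MvPolynomial σ K)} (h : ∀ i, pderiv i F ∈ I) : F ∈ I := by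
  cases nonempty_fintype σ
  have smul_mem : (d : K) • F ∈ I := by
    rw [Nat.cast_smul_eq_nsmul, ← hF.sum_X_mul_pderiv]
    exact Ideal.sum_mem _ fun i _ => Ideal.mul_mem_left _ _ (h i)
  exact (Submodule.smul_mem_iff (I.restrictScalars K) (Nat.cast_ne_zero.mpr hd)).mp smul_mem

theorem derivativeIdeal_eq_span_length_eq [Finite σ] (hF : F.IsHomogeneous d) (hkd : k ≤ d) :
    derivativeIdeal k F = Ideal.span {H | ∃ L : List σ, L.length = k ∧ H = iteratedPderiv L F} := by
  refine le_antisymm (derivativeIdeal_le_iff.mpr fun L hL => ?_)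
    (Ideal.span_mono fun _ ⟨L, hL, hH⟩ => ⟨L, hL.le, hH⟩)
  obtain ⟨t, ht⟩ := Nat.exists_eq_add_of_le hL
  induction t generalizing L with
  | zero => exact Ideal.subset_span ⟨L, ht.symm, rfl⟩
  | succ t ih =>
    exact mem_of_forall_pderiv_mem (isHomogeneous_iteratedPderiv hF L) (by lia) fun i =>
      ih (i :: L) (by grind) (by grind)

theorem jacobianIdeal_eq_derivativeIdeal {n : ℕ} {f : MvPolynomial (Fin (n + 1)) ℂ}
    (hf : f.IsHomogeneous d) (hkd : k ≤ d) : jacobianIdeal k f = derivativeIdeal k f :=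
  (derivativeIdeal_eq_span_length_eq hf hkd).symm

attribute [local instance] MvPolynomial.gradedAlgebra in
theorem isHomogeneous_jacobianIdeal {n : ℕ} {f : MvPolynomial (Fin (n + 1)) ℂ}
    (hf : f.IsHomogeneous d) (k : ℕ) :
    (jacobianIdeal k f).IsHomogeneous (homogeneousSubmodule (Fin (n + 1)) ℂ) := by
  refine Ideal.homogeneous_span _ _ ?_
  rintro _ ⟨L, -, rfl⟩
  exact ⟨_, isHomogeneous_iteratedPderiv hf L⟩

end EulerIdentity

section QuotientSupKer

/-- A surjection `A → B` identifies the quotient of `A` by an ideal containing its kernel with a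
quotient of `B`. -/
def quotientSupKerEquiv {K A B : Type*} [CommRing K] [CommRing A] [CommRing B] [Algebra K A]
    [Algebra K B] (φ : A →ₐ[K] B) (hφ : Function.Surjective φ) (I : Ideal A) :
    (A ⧸ I ⊔ RingHom.ker φ) ≃ₐ[K] B ⧸ I.map φ :=
  (Ideal.quotientEquivAlgOfEq K ((Ideal.comap_map_of_surjective' φ hφ I).symm.trans
    (SetLike.ext fun _ => (Ideal.Quotient.eq_zero_iff_mem (I := I.map φ)).symm))).trans
  (Ideal.quotientKerAlgEquivOfSurjective (f := (Ideal.Quotient.mkₐ K (I.map φ)).comp φ)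
    ((Ideal.Quotient.mkₐ_surjective K _).comp hφ))

end QuotientSupKer

section Dehomogenization

variable {n : ℕ} {K : Type*} [CommRing K] (c : Fin (n + 1)) (b : Fin n → K)

/-- The restriction of polynomials to the affine chart `x_c = 1`, in the affine coordinates centred
at the point with coordinates `b`. -/
def dehomogenize : MvPolynomial (Fin (n + 1)) K →ₐ[K] MvPolynomial (Fin n) K :=
  aeval (c.insertNth (α := fun _ => MvPolynomial (Fin n) K) 1 fun j => C (b j) + X j)

/-- The homogeneous coordinates of the point of the chart `x_c = 1` with affine coordinates `b`. -/
def chartVector : Fin (n + 1) → K :=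
  c.insertNth (α := fun _ => K) 1 b

@[simp]
theorem dehomogenize_X_self : dehomogenize c b (X c) = 1 := by
  simp [dehomogenize]

@[simp]
theorem dehomogenize_X_succAbove (j : Fin n) :
    dehomogenize c b (X (c.succAbove j)) = C (b j) + X j := by
  simp [dehomogenize]

@[simp]
theorem dehomogenize_C (r : K) : dehomogenize c b (C r) = C r := by
  simp [dehomogenize, algebraMap_eq]

@[simp]
theorem chartVector_self : chartVector c b c = 1 := by
  simp [chartVector]

@[simp]
theorem chartVector_succAbove (j : Fin n) : chartVector c b (c.succAbove j) = b j := by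
  simp [chartVector]

theorem eval_zero_dehomogenize (F : MvPolynomial (Fin (n + 1)) K) :
    eval 0 (dehomogenize c b F) = eval (chartVector c b) F := by
  suffices (aeval (0 : Fin n → K)).comp (dehomogenize c b) = aeval (chartVector c b) from
    DFunLike.congr_fun this F
  refine algHom_ext fun i => ?_
  rcases Fin.eq_self_or_eq_succAbove c i with rfl | ⟨j, rfl⟩ <;> simp

theorem pderiv_dehomogenize (j : Fin n) (F : MvPolynomial (Fin (n + 1)) K) :
    pderiv j (dehomogenize c b F) = dehomogenize c b (pderiv (c.succAbove j) F) := by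
  classical
  induction F using MvPolynomial.induction_on with
  | C r => simp
  | add p q hp hq => simp only [map_add, hp, hq]
  | mul_X p i hp =>
    simp only [map_mul, pderiv_mul, map_add, hp]
    congr 2
    rcases Fin.eq_self_or_eq_succAbove c i with rfl | ⟨i, rfl⟩
    · simp [pderiv_X_of_ne (Fin.succAbove_ne i j).symm]
    · rcases eq_or_ne i j with rfl | hij
      · simp
      · simp [hij]

theorem dehomogenize_surjective : Function.Surjective (dehomogenize c b) := by
  rw [← AlgHom.range_eq_top, ← top_le_iff, ← adjoin_range_X, Algebra.adjoin_le_iff]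
  rintro _ ⟨j, rfl⟩
  exact ⟨X (c.succAbove j) - C (b j), by simp⟩

theorem ker_dehomogenize : RingHom.ker (dehomogenize c b) = Ideal.span {X c - 1} := by
  refine le_antisymm (fun F hF => ?_) ?_
  · let π := Ideal.Quotient.mkₐ K (Ideal.span {(X c - 1 : MvPolynomial (Fin (n + 1)) K)})
    let s : MvPolynomial (Fin n) K →ₐ[K] MvPolynomial (Fin (n + 1)) K :=
      aeval fun j => X (c.succAbove j) - C (b j)
    have π_X_self : π (X c) = 1 := by
      rw [← map_one π]
      exact Ideal.Quotient.eq.mpr (Ideal.mem_span_singleton_self _)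
    have π_factors : (π.comp s).comp (dehomogenize c b) = π := by
      refine algHom_ext fun i => ?_
      rcases Fin.eq_self_or_eq_succAbove c i with rfl | ⟨j, rfl⟩
      · simp [π_X_self]
      · simp [s, ← algebraMap_eq]
    have π_F : π F = 0 := by
      rw [← π_factors, AlgHom.comp_apply, RingHom.mem_ker.mp hF, map_zero]
    exact Ideal.Quotient.eq_zero_iff_mem.mp π_F
  · rw [Ideal.span_singleton_le_iff_mem]
    simp [RingHom.mem_ker]

theorem map_dehomogenize_pointIdeal :
    (pointIdeal (chartVector c b)).map (dehomogenize c b) = idealOfVars (Fin n) K := by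
  refine le_antisymm ?_ ?_
  · rw [pointIdeal, Ideal.map_span, Ideal.span_le]
    rintro _ ⟨F, ⟨-, hF⟩, rfl⟩
    rwa [SetLike.mem_coe, mem_idealOfVars_iff_eval, eval_zero_dehomogenize]
  · rw [idealOfVars, Ideal.span_le]
    rintro _ ⟨j, rfl⟩
    have form_mem : X (c.succAbove j) - C (b j) * X c ∈ pointIdeal (chartVector c b) :=
      Ideal.subset_span
        ⟨(isHomogeneous_X K _).sub (isHomogeneous_C_mul_X _ _), by simp⟩
    simpa using Ideal.mem_map_of_mem (dehomogenize c b) form_mem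

/-- By Euler's identity, the derivative along the dehomogenized variable is a combination of the
polynomial itself and of its derivatives along the other variables. -/
theorem dehomogenize_pderiv_mem {F : MvPolynomial (Fin (n + 1)) K} {d : ℕ}
    (hF : F.IsHomogeneous d) {I : Ideal (MvPolynomial (Fin n) K)} (hFI : dehomogenize c b F ∈ I)
    (hI : ∀ j, pderiv j (dehomogenize c b F) ∈ I) (i : Fin (n + 1)) :
    dehomogenize c b (pderiv i F) ∈ I := by
  rcases Fin.eq_self_or_eq_succAbove c i with rfl | ⟨j, rfl⟩
  · have euler := congrArg (dehomogenize i b) hF.sum_X_mul_pderiv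
    rw [Fin.sum_univ_succAbove _ i, map_add, map_mul, dehomogenize_X_self, one_mul, map_sum,
      map_nsmul] at euler
    rw [eq_sub_of_add_eq euler]
    refine sub_mem (nsmul_mem hFI _) (Ideal.sum_mem _ fun j _ => ?_)
    rw [map_mul, ← pderiv_dehomogenize]
    exact Ideal.mul_mem_left _ _ (hI j)
  · rw [← pderiv_dehomogenize]
    exact hI j

theorem iteratedPderiv_dehomogenize (L : List (Fin n)) (F : MvPolynomial (Fin (n + 1)) K) :
    iteratedPderiv L (dehomogenize c b F) =
      dehomogenize c b (iteratedPderiv (L.map c.succAbove) F) := by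
  induction L with
  | nil => rfl
  | cons i L ih =>
    simp only [iteratedPderiv, List.foldr_cons, List.map_cons] at ih ⊢
    rw [ih, pderiv_dehomogenize]

theorem map_dehomogenize_derivativeIdeal {F : MvPolynomial (Fin (n + 1)) K} {d : ℕ}
    (hF : F.IsHomogeneous d) (k : ℕ) :
    (derivativeIdeal k F).map (dehomogenize c b) = derivativeIdeal k (dehomogenize c b F) := by
  refine le_antisymm (Ideal.map_le_iff_le_comap.mpr (derivativeIdeal_le_iff.mpr fun L hL => ?_))
    (derivativeIdeal_le_iff.mpr fun L hL => ?_)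
  · refine monotone_derivativeIdeal _ hL ?_
    clear hL
    induction L with
    | nil => exact iteratedPderiv_mem_derivativeIdeal (L := []) le_rfl
    | cons i L ih =>
      exact dehomogenize_pderiv_mem c b (isHomogeneous_iteratedPderiv hF L)
        (monotone_derivativeIdeal _ L.length.le_succ ih) (pderiv_mem_derivativeIdeal ih) i
  · rw [iteratedPderiv_dehomogenize]
    exact Ideal.mem_map_of_mem _ (iteratedPderiv_mem_derivativeIdeal (by simpa using hL))

end Dehomogenization

section ConvergentInverse

variable {n : ℕ}

theorem sum_antidiagonal_half_pow_degree_le (β : Fin n →₀ ℕ) :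
    ∑ x ∈ Finset.HasAntidiagonal.antidiagonal β, (1 / 2 : ℝ) ^ x.1.degree ≤ 2 ^ n := by
  classical
  let fstFun (x : (Fin n →₀ ℕ) × (Fin n →₀ ℕ)) : Fin n → ℕ := x.1
  have fstFun_injOn : Set.InjOn fstFun (Finset.HasAntidiagonal.antidiagonal β) :=
    fun x hx y hy hxy => by
      have fst_eq : x.1 = y.1 := DFunLike.coe_injective hxy
      refine Prod.ext fst_eq (add_left_cancel (a := x.1) ?_)
      rw [Finset.HasAntidiagonal.mem_antidiagonal.mp hx, fst_eq,
        Finset.HasAntidiagonal.mem_antidiagonal.mp hy]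
  have half_pow_degree (x : (Fin n →₀ ℕ) × (Fin n →₀ ℕ)) :
      (1 / 2 : ℝ) ^ x.1.degree = ∏ i, (1 / 2 : ℝ) ^ fstFun x i := by
    rw [Finset.prod_pow_eq_pow_sum, Finsupp.degree_eq_sum]
  calc ∑ x ∈ Finset.HasAntidiagonal.antidiagonal β, (1 / 2 : ℝ) ^ x.1.degree
    _ = ∑ y ∈ (Finset.HasAntidiagonal.antidiagonal β).image fstFun, ∏ i, (1 / 2 : ℝ) ^ y i := by
        simp only [half_pow_degree, Finset.sum_image fstFun_injOn]
    _ ≤ ∑ y ∈ Fintype.piFinset fun i => Finset.range (β i + 1), ∏ i, (1 / 2 : ℝ) ^ y i := by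
        refine Finset.sum_le_sum_of_subset_of_nonneg ?_ fun _ _ _ => by positivity
        simp only [Finset.image_subset_iff, Finset.HasAntidiagonal.mem_antidiagonal,
          Fintype.mem_piFinset, Finset.mem_range]
        rintro x rfl i
        simp [fstFun]
    _ = ∏ i, ∑ a ∈ Finset.range (β i + 1), (1 / 2 : ℝ) ^ a := (Finset.prod_univ_sum _ _).symm
    _ ≤ ∏ _i : Fin n, (2 : ℝ) :=
        Finset.prod_le_prod (fun i _ => by positivity) fun i _ => sum_geometric_two_le _
    _ = 2 ^ n := by simp

theorem mul_pow_mul_mul_pow_le {C K u M : ℝ} (hC : 0 ≤ C) (hK : 0 ≤ K) (hu : 0 ≤ u) (hM : 1 ≤ M)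
    {a : ℕ} (ha : a ≠ 0) (b : ℕ) :
    C * K ^ a * (u * (2 * M * K) ^ b) ≤
      u * C * M⁻¹ * (2 * M * K) ^ (a + b) * (1 / 2) ^ a := by
  have half_pow : (2 * M * K) ^ a * (1 / 2) ^ a = M ^ a * K ^ a := by
    rw [← mul_pow, ← mul_pow]
    ring
  calc C * K ^ a * (u * (2 * M * K) ^ b)
    _ = u * C * M⁻¹ * (M * K ^ a) * (2 * M * K) ^ b := by field_simp
    _ ≤ u * C * M⁻¹ * (M ^ a * K ^ a) * (2 * M * K) ^ b := by
        gcongr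
        exact le_self_pow₀ hM ha
    _ = _ := by rw [← half_pow, pow_add]; ring

theorem norm_coeff_inv_le {g : MvPowerSeries (Fin n) ℂ} {C K M : ℝ} (hC : 0 ≤ C) (hK : 0 ≤ K)
    (hg : ∀ α, ‖MvPowerSeries.coeff α g‖ ≤ C * K ^ α.degree)
    (hM : 1 + ‖(MvPowerSeries.constantCoeff g)⁻¹‖ * C * 2 ^ n ≤ M) (β : Fin n →₀ ℕ) :
    ‖MvPowerSeries.coeff β g⁻¹‖ ≤
      ‖(MvPowerSeries.constantCoeff g)⁻¹‖ * (2 * M * K) ^ β.degree := by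
  classical
  set u := ‖(MvPowerSeries.constantCoeff g)⁻¹‖ with hu
  have hu0 : 0 ≤ u := norm_nonneg _
  have hM1 : 1 ≤ M := (le_add_of_nonneg_right (by positivity)).trans hM
  induction β using WellFoundedLT.induction with
  | ind β ih =>
  rw [MvPowerSeries.coeff_inv]
  split_ifs with hβ
  · simp [hβ, hu]
  rw [norm_mul, norm_neg, ← hu]
  refine mul_le_mul_of_nonneg_left ?_ hu0
  have norm_term_le : ∀ x ∈ Finset.HasAntidiagonal.antidiagonal β,
      ‖if x.2 < β then MvPowerSeries.coeff x.1 g * MvPowerSeries.coeff x.2 g⁻¹ else 0‖ ≤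
        u * C * M⁻¹ * (2 * M * K) ^ β.degree * (1 / 2) ^ x.1.degree := fun x hx => by
    split_ifs with hlt
    · rw [Finset.HasAntidiagonal.mem_antidiagonal] at hx
      have degree_ne_zero : x.1.degree ≠ 0 := fun h0 => by
        rw [Finsupp.degree_eq_zero_iff] at h0
        exact hlt.ne (by simpa [h0] using hx)
      rw [norm_mul]
      refine (mul_le_mul (hg _) (ih _ hlt) (norm_nonneg _) (by positivity)).trans ?_
      rw [← hx, map_add]
      exact mul_pow_mul_mul_pow_le hC hK hu0 hM1 degree_ne_zero _
    · rw [norm_zero]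
      positivity
  calc _ ≤ ∑ x ∈ Finset.HasAntidiagonal.antidiagonal β,
          u * C * M⁻¹ * (2 * M * K) ^ β.degree * (1 / 2) ^ x.1.degree :=
        norm_sum_le_of_le _ norm_term_le
    _ ≤ u * C * M⁻¹ * (2 * M * K) ^ β.degree * 2 ^ n := by
        rw [← Finset.mul_sum]
        gcongr
        exact sum_antidiagonal_half_pow_degree_le β
    _ = (u * C * 2 ^ n) / M * (2 * M * K) ^ β.degree := by ring
    _ ≤ (2 * M * K) ^ β.degree := by
        refine mul_le_of_le_one_left (by positivity) ((div_le_one (by positivity)).mpr ?_)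
        exact (le_add_of_nonneg_left zero_le_one).trans hM

theorem isConvergent_inv {g : MvPowerSeries (Fin n) ℂ} (hg : IsConvergent g) :
    IsConvergent g⁻¹ := by
  obtain ⟨C, K, hC, hK, hg⟩ := hg
  refine ⟨‖(MvPowerSeries.constantCoeff g)⁻¹‖ + 1,
    2 * (1 + ‖(MvPowerSeries.constantCoeff g)⁻¹‖ * C * 2 ^ n) * K, by positivity, by positivity,
    fun α => (norm_coeff_inv_le hC.le hK.le hg le_rfl α).trans ?_⟩
  gcongr
  exact le_add_of_nonneg_right zero_le_one

end ConvergentInverse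

section Germs

theorem exists_sum_X_mul_eq {σ R : Type*} [Fintype σ] [CommSemiring R] {g : MvPowerSeries σ R}
    (hg : MvPowerSeries.coeff 0 g = 0) :
    ∃ q : σ → MvPowerSeries σ R, ∑ i, MvPowerSeries.X i * q i = g ∧ ∀ i α,
      MvPowerSeries.coeff α (q i) = 0 ∨
        MvPowerSeries.coeff α (q i) = MvPowerSeries.coeff (α + Finsupp.single i 1) g := by
  classical
  have exists_variable (β : σ →₀ ℕ) : ∃ i : Option σ, β ≠ 0 → ∃ j ∈ i, β j ≠ 0 := by
    by_cases hβ : β = 0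
    · exact ⟨none, fun h => absurd hβ h⟩
    · obtain ⟨j, hj⟩ := Finsupp.ne_iff.mp hβ
      exact ⟨some j, fun _ => ⟨j, rfl, hj⟩⟩
  choose v hv using exists_variable
  let q (i : σ) : MvPowerSeries σ R := fun α =>
    if v (α + Finsupp.single i 1) = some i then
      MvPowerSeries.coeff (α + Finsupp.single i 1) g else 0
  refine ⟨q, MvPowerSeries.ext fun β => ?_, fun i α => ?_⟩
  · by_cases hβ : β = 0
    · simp [hβ, hg]
    obtain ⟨j, hvj, hj⟩ := hv β hβ
    have coeff_X_mul (i : σ) : MvPowerSeries.coeff β (MvPowerSeries.X i * q i) =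
        if v β = some i then MvPowerSeries.coeff β g else 0 := by
      rw [MvPowerSeries.X, MvPowerSeries.coeff_monomial_mul, one_mul]
      by_cases hle : Finsupp.single i 1 ≤ β
      · rw [if_pos hle]
        change (if v (β - Finsupp.single i 1 + Finsupp.single i 1) = some i then _ else 0) = _
        rw [tsub_add_cancel_of_le hle]
      · rw [if_neg hle, if_neg]
        rintro hvi
        obtain rfl : j = i := Option.some_injective _ (hvj.symm.trans hvi)
        exact hle (by simpa [Nat.one_le_iff_ne_zero] using hj)
    rw [map_sum, Finset.sum_congr rfl fun i _ => coeff_X_mul i]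
    simp [Option.mem_def.mp hvj]
  · exact (em _).symm.imp (fun h => if_neg h) fun h => if_pos h

variable {n : ℕ}

/-- The germ at the origin of a polynomial. -/
def polynomialGerm (n : ℕ) : MvPolynomial (Fin n) ℂ →ₐ[ℂ] convergentPowerSeries n where
  toFun F := ⟨F, isConvergent_coe F⟩
  map_one' := Subtype.ext coe_one
  map_mul' F G := Subtype.ext (coe_mul F G)
  map_zero' := Subtype.ext coe_zero
  map_add' F G := Subtype.ext (coe_add F G)
  commutes' r := Subtype.ext (coe_C r)

@[simp]
theorem coe_polynomialGerm (F : MvPolynomial (Fin n) ℂ) :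
    (polynomialGerm n F : MvPowerSeries (Fin n) ℂ) = F :=
  rfl

theorem isUnit_polynomialGerm {F : MvPolynomial (Fin n) ℂ} (hF : eval 0 F ≠ 0) :
    IsUnit (polynomialGerm n F) := by
  refine IsUnit.of_mul_eq_one ⟨_, isConvergent_inv (isConvergent_coe F)⟩
    (Subtype.ext (MvPowerSeries.mul_inv_cancel _ ?_))
  rwa [coe_polynomialGerm, ← MvPowerSeries.coeff_zero_eq_constantCoeff_apply, coeff_coe,
    ← constantCoeff_eq, ← eval_zero]

theorem mem_map_idealOfVars_pow {N : ℕ} {g : convergentPowerSeries n}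
    (hg : ∀ α : Fin n →₀ ℕ, α.degree < N →
      MvPowerSeries.coeff α (g : MvPowerSeries (Fin n) ℂ) = 0) :
    g ∈ (idealOfVars (Fin n) ℂ ^ N).map (polynomialGerm n) := by
  induction N generalizing g with
  | zero => simp [Ideal.one_eq_top, Ideal.map_top]
  | succ N ih =>
    obtain ⟨C, K, hC, hK, norm_coeff_le⟩ := g.2
    obtain ⟨q, sum_eq, coeff_q⟩ := exists_sum_X_mul_eq (hg 0 (by simp))
    have isConvergent_q (i : Fin n) : IsConvergent (q i) := by
      refine ⟨C * K, K, by positivity, hK, fun α => ?_⟩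
      rcases coeff_q i α with h | h <;> rw [h]
      · rw [norm_zero]
        positivity
      · refine (norm_coeff_le _).trans_eq ?_
        rw [map_add, Finsupp.degree_single, pow_succ']
        ring
    have sum_germ_eq : ∑ i, polynomialGerm n (X i) * ⟨q i, isConvergent_q i⟩ = g :=
      Subtype.ext (by simpa using sum_eq)
    rw [← sum_germ_eq, pow_succ', Ideal.map_mul]
    refine Ideal.sum_mem _ fun i _ => Ideal.mul_mem_mul
      (Ideal.mem_map_of_mem _ (Ideal.subset_span ⟨i, rfl⟩)) (ih fun α hα => ?_)
    exact (coeff_q i α).elim id fun h =>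
      h.trans (hg _ (by rw [map_add, Finsupp.degree_single]; lia))

variable (n) in
/-- The map from germs to their Taylor polynomials of degree less than `N`. -/
def germTruncation (N : ℕ) :
    convergentPowerSeries n →ₐ[ℂ] MvPolynomial (Fin n) ℂ ⧸ idealOfVars (Fin n) ℂ ^ N :=
  ((MvPowerSeries.truncTotalAlgHom (Fin n) ℂ N).restrictScalars ℂ).comp
    (convergentPowerSeries n).val

theorem germTruncation_polynomialGerm (N : ℕ) (F : MvPolynomial (Fin n) ℂ) :
    germTruncation n N (polynomialGerm n F) = Ideal.Quotient.mk _ F :=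
  (MvPowerSeries.truncTotalAlgHom (Fin n) ℂ N).commutes F

theorem germTruncation_surjective (N : ℕ) : Function.Surjective (germTruncation n N) := fun x => by
  obtain ⟨F, rfl⟩ := Ideal.Quotient.mk_surjective x
  exact ⟨_, germTruncation_polynomialGerm N F⟩

theorem ker_germTruncation (N : ℕ) :
    RingHom.ker (germTruncation n N) = (idealOfVars (Fin n) ℂ ^ N).map (polynomialGerm n) := by
  refine le_antisymm (fun g hg => ?_) (Ideal.map_le_iff_le_comap.mpr fun F hF => ?_)
  · have truncTotal_mem : MvPowerSeries.truncTotal N (g : MvPowerSeries (Fin n) ℂ) ∈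
        idealOfVars (Fin n) ℂ ^ N := Ideal.Quotient.eq_zero_iff_mem.mp hg
    refine mem_map_idealOfVars_pow fun α hα => ?_
    rw [← MvPowerSeries.coeff_truncTotal _ hα]
    exact (mem_pow_idealOfVars_iff' _ _).mp truncTotal_mem α hα
  · rw [Ideal.mem_comap, RingHom.mem_ker, germTruncation_polynomialGerm]
    exact Ideal.Quotient.eq_zero_iff_mem.mpr hF

theorem map_germTruncation_map_polynomialGerm (N : ℕ) (I : Ideal (MvPolynomial (Fin n) ℂ)) :
    (I.map (polynomialGerm n)).map (germTruncation n N) =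
      I.map (Ideal.Quotient.mkₐ ℂ (idealOfVars (Fin n) ℂ ^ N)) := by
  rw [Ideal.map_mapₐ]
  congr 1
  exact AlgHom.ext (germTruncation_polynomialGerm N)

theorem map_polynomialGerm_idealOfVars_pow_le {I : Ideal (MvPolynomial (Fin n) ℂ)}
    {h : MvPolynomial (Fin n) ℂ} {N : ℕ} (hh : eval 0 h ≠ 0)
    (hI : Ideal.span {h} * idealOfVars (Fin n) ℂ ^ N ≤ I) :
    (idealOfVars (Fin n) ℂ ^ N).map (polynomialGerm n) ≤ I.map (polynomialGerm n) := by
  have span_germ_eq_top : (Ideal.span {h}).map (polynomialGerm n) = ⊤ := by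
    rw [Ideal.map_span, Set.image_singleton, Ideal.span_singleton_eq_top]
    exact isUnit_polynomialGerm hh
  simpa [Ideal.map_mul, span_germ_eq_top] using Ideal.map_mono (f := polynomialGerm n) hI

/-- Passing to germs at the origin replaces `I` by its component supported there, which contains a
power of the maximal ideal when the origin is an isolated zero. -/
def germQuotientEquiv {I : Ideal (MvPolynomial (Fin n) ℂ)} {h : MvPolynomial (Fin n) ℂ}
    {N : ℕ} (hh : eval 0 h ≠ 0) (hI : Ideal.span {h} * idealOfVars (Fin n) ℂ ^ N ≤ I) :
    (convergentPowerSeries n ⧸ I.map (polynomialGerm n)) ≃ₐ[ℂ]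
      MvPolynomial (Fin n) ℂ ⧸ I ⊔ idealOfVars (Fin n) ℂ ^ N :=
  (Ideal.quotientEquivAlgOfEq ℂ (by
    rw [ker_germTruncation,
      sup_eq_left.mpr (map_polynomialGerm_idealOfVars_pow_le hh hI)])).trans <|
  (quotientSupKerEquiv (germTruncation n N) (germTruncation_surjective N)
    (I.map (polynomialGerm n))).trans <|
  (Ideal.quotientEquivAlgOfEq ℂ (map_germTruncation_map_polynomialGerm N I)).trans <|
  (quotientSupKerEquiv (Ideal.Quotient.mkₐ ℂ (idealOfVars (Fin n) ℂ ^ N))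
    (Ideal.Quotient.mkₐ_surjective ℂ _) I).symm.trans <|
  Ideal.quotientEquivAlgOfEq ℂ (congrArg (I ⊔ ·) (Ideal.Quotient.mkₐ_ker ℂ _))

theorem foldr_germPderiv_polynomialGerm (L : List (Fin n)) (F : MvPolynomial (Fin n) ℂ) :
    L.foldr germPderiv (polynomialGerm n F) = polynomialGerm n (iteratedPderiv L F) := by
  induction L with
  | nil => rfl
  | cons i L ih =>
    rw [List.foldr_cons, ih]
    exact Subtype.ext (MvPowerSeries.pderiv_coe _)

theorem tjurinaIdeal_polynomialGerm (k : ℕ) (F : MvPolynomial (Fin n) ℂ) :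
    tjurinaIdeal k (polynomialGerm n F) = (derivativeIdeal k F).map (polynomialGerm n) := by
  rw [derivativeIdeal, Ideal.map_span, tjurinaIdeal]
  congr 1
  ext g
  simp only [foldr_germPderiv_polynomialGerm]
  constructor
  · rintro ⟨L, hL, rfl⟩
    exact ⟨_, ⟨L, hL, rfl⟩, rfl⟩
  · rintro ⟨_, ⟨L, hL, rfl⟩, rfl⟩
    exact ⟨L, hL, rfl⟩

end Germs

section ArtinianCriterion

variable {σ K : Type*}

attribute [local instance] MvPolynomial.gradedAlgebra in
theorem isNilpotent_mk_of_isArtinianRing [CommRing K] {J : Ideal (MvPolynomial σ K)}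
    (hJ : J.IsHomogeneous (homogeneousSubmodule σ K)) [IsArtinianRing (MvPolynomial σ K ⧸ J)]
    {l : MvPolynomial σ K} (hl : l.IsHomogeneous 1) : IsNilpotent (Ideal.Quotient.mk J l) := by
  obtain ⟨m, y, hy⟩ := IsArtinian.exists_pow_succ_smul_dvd (Ideal.Quotient.mk J l)
    (1 : MvPolynomial σ K ⧸ J)
  obtain ⟨b, rfl⟩ := Ideal.Quotient.mk_surjective y
  have sub_mem : l ^ (m + 1) * b - l ^ m ∈ J := by
    rw [← Ideal.Quotient.mk_eq_mk_iff_sub_mem]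
    simpa using hy
  have component_mul : homogeneousComponent m (l ^ (m + 1) * b) = 0 := by
    have h := DirectSum.coe_decompose_mul_of_left_mem_of_not_le (homogeneousSubmodule σ K)
      (b := b) ((mem_homogeneousSubmodule _ _).mpr (hl.pow (m + 1)))
      (by lia : ¬ 1 * (m + 1) ≤ m)
    rwa [← decomposition.decompose'_apply]
  have component_pow : homogeneousComponent m (l ^ m) = l ^ m :=
    homogeneousComponent_eq_self (by simpa using hl.pow m)
  have component_mem := homogeneousComponent_mem_of_mem hJ sub_mem m
  rw [map_sub, component_mul, component_pow, zero_sub, neg_mem_iff] at component_mem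
  exact ⟨m, by rwa [← map_pow, Ideal.Quotient.eq_zero_iff_mem]⟩

theorem finite_quotient_of_forall_isNilpotent_mk_X [CommRing K] [Finite σ]
    {J : Ideal (MvPolynomial σ K)} (h : ∀ i, IsNilpotent (Ideal.Quotient.mk J (X i))) :
    Module.Finite K (MvPolynomial σ K ⧸ J) := by
  have isIntegral_mk (F : MvPolynomial σ K) : IsIntegral K (Ideal.Quotient.mk J F) := by
    induction F using MvPolynomial.induction_on with
    | C r => exact isIntegral_algebraMap
    | add F G hF hG => simpa using hF.add hG
    | mul_X F i hF =>
      obtain ⟨m, hm⟩ := h i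
      refine (map_mul (Ideal.Quotient.mk J) F (X i)).symm ▸ hF.mul (.of_pow m.succ_pos ?_)
      rw [pow_succ, hm, zero_mul]
      exact isIntegral_zero
  have : Algebra.IsIntegral K (MvPolynomial σ K ⧸ J) :=
    ⟨Ideal.Quotient.mk_surjective.forall.mpr isIntegral_mk⟩
  exact Algebra.IsIntegral.finite

attribute [local instance] MvPolynomial.gradedAlgebra in
theorem isArtinianRing_quotient_iff_zeroLocus_subset [Field K] [IsAlgClosed K] [Finite σ]
    {J : Ideal (MvPolynomial σ K)} (hJ : J.IsHomogeneous (homogeneousSubmodule σ K)) :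
    IsArtinianRing (MvPolynomial σ K ⧸ J) ↔ zeroLocus K J ⊆ {0} := by
  refine ⟨fun _ v hv => funext fun i => ?_, fun h => ?_⟩
  · obtain ⟨m, hm⟩ := isNilpotent_mk_of_isArtinianRing hJ (isHomogeneous_X K i)
    rw [← map_pow, Ideal.Quotient.eq_zero_iff_mem] at hm
    exact eq_zero_of_pow_eq_zero (by simpa using mem_zeroLocus_iff_eval.mp hv _ hm)
  · obtain ⟨N, hN⟩ := exists_pow_idealOfVars_le h
    have isNilpotent_mk_X (i : σ) : IsNilpotent (Ideal.Quotient.mk J (X i)) := by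
      refine ⟨N, ?_⟩
      rw [← map_pow, Ideal.Quotient.eq_zero_iff_mem]
      exact hN (Ideal.pow_mem_pow (Ideal.subset_span (Set.mem_range_self i)) N)
    have := finite_quotient_of_forall_isNilpotent_mk_X isNilpotent_mk_X
    exact IsArtinianRing.of_finite K _

attribute [local instance] MvPolynomial.gradedAlgebra in
theorem smul_mem_zeroLocus [Field K] {J : Ideal (MvPolynomial σ K)}
    (hJ : J.IsHomogeneous (homogeneousSubmodule σ K)) {v : σ → K} (hv : v ∈ zeroLocus K J)
    (c : K) : c • v ∈ zeroLocus K J := by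
  refine mem_zeroLocus_iff_eval.mpr fun F hF => ?_
  rw [← sum_homogeneousComponent F, map_sum]
  refine Finset.sum_eq_zero fun i _ => ?_
  rw [eval_smul_of_isHomogeneous (homogeneousComponent_isHomogeneous i F),
    mem_zeroLocus_iff_eval.mp hv _ (homogeneousComponent_mem_of_mem hJ hF i), mul_zero]

attribute [local instance] MvPolynomial.gradedAlgebra in
theorem mem_zeroLocus_of_mem_span_singleton [Field K] {J : Ideal (MvPolynomial σ K)}
    (hJ : J.IsHomogeneous (homogeneousSubmodule σ K)) {v w : σ → K} (hv : v ∈ zeroLocus K J)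
    (hw : w ∈ K ∙ v) : w ∈ zeroLocus K J := by
  obtain ⟨c, rfl⟩ := Submodule.mem_span_singleton.mp hw
  exact smul_mem_zeroLocus hJ hv c

end ArtinianCriterion

section IsolatedZeros

variable {σ K : Type*} [Field K]

theorem exists_mem_pointIdeal_eval_ne_zero {a b : σ → K} (hab : b ∉ K ∙ a) :
    ∃ F ∈ pointIdeal a, eval b F ≠ 0 := by
  by_contra! h
  exact hab (zeroLocus_pointIdeal_pow_subset a 1 (by simpa [mem_zeroLocus_iff_eval] using h))

theorem exists_span_mul_pointIdeal_pow_le [IsAlgClosed K] [Finite σ]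
    {J : Ideal (MvPolynomial σ K)} {ι : Type*} [Finite ι] {a : ι → σ → K}
    (hpair : Pairwise fun i j => a j ∉ K ∙ a i)
    (hzero : ∀ v ∈ zeroLocus K J, v ≠ 0 → ∃ i, v ∈ K ∙ a i) (i : ι) :
    ∃ (N : ℕ) (h : MvPolynomial σ K), eval (a i) h ≠ 0 ∧
      Ideal.span {h} * pointIdeal (a i) ^ N ≤ J := by
  classical
  cases nonempty_fintype ι
  have exists_separating (j : ι) :
      ∃ F : MvPolynomial σ K, (j ≠ i → F ∈ pointIdeal (a j)) ∧ eval (a i) F ≠ 0 := by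
    by_cases hj : j = i
    · exact ⟨1, fun h => absurd hj h, by simp⟩
    · obtain ⟨F, hF, hFi⟩ := exists_mem_pointIdeal_eval_ne_zero (hpair hj)
      exact ⟨F, fun _ => hF, hFi⟩
  choose G hG eval_G using exists_separating
  obtain ⟨N, hN⟩ : ∃ N, (Ideal.span {∏ j, G j} * pointIdeal (a i)) ^ N ≤ J := by
    refine exists_pow_le_of_zeroLocus_subset fun v hv => ?_
    suffices ∃ j, v ∈ K ∙ a j ∧ Ideal.span {∏ j, G j} * pointIdeal (a i) ≤ pointIdeal (a j) by
      obtain ⟨j, hvj, hle⟩ := this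
      exact zeroLocus_anti_mono hle (span_singleton_subset_zeroLocus_pointIdeal (a j) hvj)
    rcases eq_or_ne v 0 with rfl | hv0
    · exact ⟨i, zero_mem _, Ideal.mul_le_right⟩
    · obtain ⟨j, hvj⟩ := hzero v hv hv0
      refine ⟨j, hvj, ?_⟩
      rcases eq_or_ne j i with rfl | hji
      · exact Ideal.mul_le_right
      · exact Ideal.mul_le_left.trans ((Ideal.span_singleton_le_iff_mem _).mpr
          (Ideal.mem_of_dvd _ (Finset.dvd_prod_of_mem G (Finset.mem_univ j)) (hG j hji)))
  refine ⟨N, (∏ j, G j) ^ N, ?_, ?_⟩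
  · rw [map_pow, map_prod]
    exact pow_ne_zero _ (Finset.prod_ne_zero_iff.mpr fun j _ => eval_G j)
  · rwa [← Ideal.span_singleton_pow, ← mul_pow]

end IsolatedZeros

section Multiplicity

variable {n : ℕ}

/-- The coordinates of `p` in the affine chart indexed by `chartIndex p`. -/
def chartCoordinates (p : ProjSpace n) (j : Fin n) : ℂ :=
  p.rep ((chartIndex p).succAbove j) / p.rep (chartIndex p)

/-- The homogeneous coordinates of `p` whose coordinate of index `chartIndex p` is `1`. -/
def chartPoint (p : ProjSpace n) : Fin (n + 1) → ℂ :=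
  chartVector (chartIndex p) (chartCoordinates p)

theorem localEquation_eq_dehomogenize (f : MvPolynomial (Fin (n + 1)) ℂ) (p : ProjSpace n) :
    localEquation f p = dehomogenize (chartIndex p) (chartCoordinates p) f :=
  rfl

theorem chartPoint_chartIndex (p : ProjSpace n) : chartPoint p (chartIndex p) = 1 :=
  chartVector_self _ _

theorem rep_eq_smul_chartPoint (p : ProjSpace n) :
    p.rep = p.rep (chartIndex p) • chartPoint p := by
  have := rep_chartIndex_ne_zero p
  refine funext fun i => ?_
  rcases Fin.eq_self_or_eq_succAbove (chartIndex p) i with hi | ⟨j, hj⟩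
  · simp [hi, chartPoint]
  · rw [hj, Pi.smul_apply, chartPoint, chartVector_succAbove, chartCoordinates, smul_eq_mul,
      mul_div_cancel₀ _ this]

theorem span_chartPoint (p : ProjSpace n) : ℂ ∙ chartPoint p = p.submodule := by
  rw [p.submodule_eq, rep_eq_smul_chartPoint p,
    Submodule.span_singleton_smul_eq (rep_chartIndex_ne_zero p).isUnit]

theorem chartPoint_ne_zero (p : ProjSpace n) : chartPoint p ≠ 0 := fun h =>
  one_ne_zero ((chartPoint_chartIndex p).symm.trans (congrFun h _))

theorem mk_chartPoint (p : ProjSpace n) :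
    Projectivization.mk ℂ (chartPoint p) (chartPoint_ne_zero p) = p :=
  Projectivization.submodule_injective
    ((Projectivization.submodule_mk _ _).trans (span_chartPoint p))

theorem eq_of_chartPoint_mem_span {p q : ProjSpace n} (h : chartPoint q ∈ ℂ ∙ chartPoint p) :
    p = q := by
  obtain ⟨c, hc⟩ := Submodule.mem_span_singleton.mp h
  rw [← mk_chartPoint p, ← mk_chartPoint q]
  exact ((Projectivization.mk_eq_mk_iff' ℂ _ _ _ _).mpr ⟨c, hc⟩).symm

variable {f : MvPolynomial (Fin (n + 1)) ℂ} {k d : ℕ}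

theorem lt_hypersurfaceMultiplicity_iff_localEquation_mem {p : ProjSpace n} :
    (k : ℕ∞) < hypersurfaceMultiplicity f p ↔
      localEquation f p ∈ idealOfVars (Fin n) ℂ ^ (k + 1) := by
  rw [mem_pow_idealOfVars_iff']
  refine ⟨fun h α hα => ?_, fun h => ?_⟩
  · rw [← coeff_coe]
    exact MvPowerSeries.coeff_of_lt_order ((Nat.cast_le.mpr (Nat.lt_succ_iff.mp hα)).trans_lt h)
  · refine (Nat.cast_lt.mpr k.lt_succ_self).trans_le
      (MvPowerSeries.nat_le_order fun α hα => ?_)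
    exact (coeff_coe _ _).trans (h α (by exact_mod_cast hα))

theorem map_dehomogenize_jacobianIdeal (hf : f.IsHomogeneous d) (hkd : k ≤ d) (p : ProjSpace n) :
    (jacobianIdeal k f).map (dehomogenize (chartIndex p) (chartCoordinates p)) =
      derivativeIdeal k (localEquation f p) := by
  rw [jacobianIdeal_eq_derivativeIdeal hf hkd, map_dehomogenize_derivativeIdeal _ _ hf,
    localEquation_eq_dehomogenize]

theorem lt_hypersurfaceMultiplicity_iff_chartPoint_mem (hf : f.IsHomogeneous d) (hkd : k ≤ d)
    {p : ProjSpace n} :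
    (k : ℕ∞) < hypersurfaceMultiplicity f p ↔ chartPoint p ∈ zeroLocus ℂ (jacobianIdeal k f) := by
  rw [lt_hypersurfaceMultiplicity_iff_localEquation_mem, ← derivativeIdeal_le_idealOfVars_iff,
    ← map_dehomogenize_jacobianIdeal hf hkd, Ideal.map_le_iff_le_comap, mem_zeroLocus_iff_eval]
  refine forall₂_congr fun F _ => ?_
  rw [Ideal.mem_comap, mem_idealOfVars_iff_eval, eval_zero_dehomogenize, chartPoint]

theorem lt_hypersurfaceMultiplicity_iff (hf : f.IsHomogeneous d) (hkd : k ≤ d) {p : ProjSpace n}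
    {v : Fin (n + 1) → ℂ} (hv : p.submodule = ℂ ∙ v) :
    (k : ℕ∞) < hypersurfaceMultiplicity f p ↔ v ∈ zeroLocus ℂ (jacobianIdeal k f) := by
  rw [lt_hypersurfaceMultiplicity_iff_chartPoint_mem hf hkd]
  rw [← span_chartPoint] at hv
  have hJ := isHomogeneous_jacobianIdeal hf k
  exact ⟨fun h => mem_zeroLocus_of_mem_span_singleton hJ h
      (hv ▸ Submodule.mem_span_singleton_self v),
    fun h => mem_zeroLocus_of_mem_span_singleton hJ h
      (hv ▸ Submodule.mem_span_singleton_self (chartPoint p))⟩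

theorem eval_rep_iteratedPderiv_eq_zero (hf : f.IsHomogeneous d) (hkd : k ≤ d) {p : ProjSpace n}
    (h : k < hypersurfaceMultiplicity f p) {L : List (Fin (n + 1))} (hL : L.length ≤ k) :
    eval p.rep (iteratedPderiv L f) = 0 := by
  rw [lt_hypersurfaceMultiplicity_iff hf hkd p.submodule_eq,
    jacobianIdeal_eq_derivativeIdeal hf hkd, mem_zeroLocus_iff_eval] at h
  exact h _ (iteratedPderiv_mem_derivativeIdeal hL)

theorem mem_hypersurface_of_lt_hypersurfaceMultiplicity (hf : f.IsHomogeneous d) (hkd : k ≤ d)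
    {p : ProjSpace n} (h : k < hypersurfaceMultiplicity f p) : p ∈ hypersurface f :=
  eval_rep_iteratedPderiv_eq_zero hf hkd h (L := []) k.zero_le

theorem mem_singularLocus_of_lt_hypersurfaceMultiplicity (hf : f.IsHomogeneous d) (hkd : k ≤ d)
    (hk : 1 ≤ k) {p : ProjSpace n} (h : k < hypersurfaceMultiplicity f p) :
    p ∈ singularLocus f :=
  ⟨mem_hypersurface_of_lt_hypersurfaceMultiplicity hf hkd h,
    fun i => eval_rep_iteratedPderiv_eq_zero hf hkd h (L := [i]) hk⟩

theorem zeroLocus_jacobianIdeal_subset_iff (hf : f.IsHomogeneous d) (hkd : k ≤ d) :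
    zeroLocus ℂ (jacobianIdeal k f) ⊆ {0} ↔
      ∀ p ∈ hypersurface f, hypersurfaceMultiplicity f p ≤ k := by
  refine ⟨fun h p _ => ?_, fun h v hv => ?_⟩
  · by_contra! hlt
    exact chartPoint_ne_zero p (h ((lt_hypersurfaceMultiplicity_iff_chartPoint_mem hf hkd).mp hlt))
  · by_contra hv0
    have hlt := (lt_hypersurfaceMultiplicity_iff hf hkd
      (Projectivization.submodule_mk v hv0)).mpr hv
    exact (h _ (mem_hypersurface_of_lt_hypersurfaceMultiplicity hf hkd hlt)).not_gt hlt

theorem exists_mem_span_chartPoint {ι : Type*} {p : ι → ProjSpace n} (hf : f.IsHomogeneous d)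
    (hkd : k ≤ d) (hp : ∀ q, k < hypersurfaceMultiplicity f q → q ∈ Set.range p)
    {v : Fin (n + 1) → ℂ} (hv : v ∈ zeroLocus ℂ (jacobianIdeal k f)) (hv0 : v ≠ 0) :
    ∃ i, v ∈ ℂ ∙ chartPoint (p i) := by
  have submodule_mk := Projectivization.submodule_mk (K := ℂ) v hv0
  obtain ⟨i, hi⟩ := hp _ ((lt_hypersurfaceMultiplicity_iff hf hkd submodule_mk).mpr hv)
  refine ⟨i, ?_⟩
  rw [span_chartPoint, hi, submodule_mk]
  exact Submodule.mem_span_singleton_self v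

end Multiplicity

section Tjurina

variable {n : ℕ} {f : MvPolynomial (Fin (n + 1)) ℂ} {k d : ℕ}

/-- Once the `N`-th power of the maximal ideal at `p` lies in the localization of `J^k(f)` at `p`,
the Tjurina algebra of `V(f)` at `p` is the quotient of the coordinate ring of the affine chart
around `p` by `J^k(f)` and the `N`-th power of the ideal of `p`. -/
def tjurinaAlgebraEquiv (hf : f.IsHomogeneous d) (hkd : k ≤ d) {p : ProjSpace n}
    {h : MvPolynomial (Fin (n + 1)) ℂ} (hh : eval (chartPoint p) h ≠ 0) {N : ℕ}
    (hN : Ideal.span {h} * pointIdeal (chartPoint p) ^ N ≤ jacobianIdeal k f) :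
    (MvPolynomial (Fin (n + 1)) ℂ ⧸
        jacobianIdeal k f ⊔ pointIdeal (chartPoint p) ^ N ⊔ Ideal.span {X (chartIndex p) - 1}) ≃ₐ[ℂ]
      TjurinaAlgebra k (localGerm f p) := by
  let δ := dehomogenize (chartIndex p) (chartCoordinates p)
  have eval_δ_h : eval 0 (δ h) ≠ 0 := by rwa [eval_zero_dehomogenize]
  have map_pointIdeal_pow : (pointIdeal (chartPoint p) ^ N).map δ = idealOfVars (Fin n) ℂ ^ N := by
    rw [Ideal.map_pow, chartPoint, map_dehomogenize_pointIdeal]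
  have map_jacobianIdeal : (jacobianIdeal k f).map δ = derivativeIdeal k (localEquation f p) :=
    map_dehomogenize_jacobianIdeal hf hkd p
  have span_mul_le : Ideal.span {δ h} * idealOfVars (Fin n) ℂ ^ N ≤
      derivativeIdeal k (localEquation f p) := by
    have := Ideal.map_mono (f := δ) hN
    rwa [Ideal.map_mul, Ideal.map_span, Set.image_singleton, map_pointIdeal_pow,
      map_jacobianIdeal] at this
  have map_sup : (jacobianIdeal k f ⊔ pointIdeal (chartPoint p) ^ N).map δ =
      derivativeIdeal k (localEquation f p) ⊔ idealOfVars (Fin n) ℂ ^ N := by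
    rw [Ideal.map_sup, map_pointIdeal_pow, map_jacobianIdeal]
  exact
    (Ideal.quotientEquivAlgOfEq ℂ (by rw [ker_dehomogenize])).trans <|
    (quotientSupKerEquiv δ (dehomogenize_surjective _ _) _).trans <|
    (Ideal.quotientEquivAlgOfEq ℂ map_sup).trans <|
    (germQuotientEquiv eval_δ_h span_mul_le).symm.trans <|
    Ideal.quotientEquivAlgOfEq ℂ (tjurinaIdeal_polynomialGerm k (localEquation f p)).symm

end Tjurina

end HigherMilnor

end

open MvPolynomial HigherMilnor in
theorem theorem3p2_general {n d k : ℕ} {f : MvPolynomial (Fin (n + 1)) ℂ}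
    (hf : f.IsHomogeneous d) (hkd : k ≤ d) :
    (IsArtinianRing (MilnorAlgebra k f) ↔
      ∀ p ∈ hypersurface f, hypersurfaceMultiplicity f p ≤ k) ∧
    ∀ {ι : Type*} [Fintype ι] {p : ι → ProjSpace n}, Function.Injective p →
      (∀ q, k < hypersurfaceMultiplicity f q → q ∈ Set.range p) →
        (∀ i, Module.Finite ℂ (TjurinaAlgebra k (localGerm f (p i)))) ∧
        ∃ m₀ : ℕ, ∀ m ≥ m₀,
          Module.finrank ℂ (milnorPiece k f m) = ∑ i, tjurinaNumber k f (p i) := by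
  have hJ := isHomogeneous_jacobianIdeal hf k
  refine ⟨(isArtinianRing_quotient_iff_zeroLocus_subset hJ).trans
    (zeroLocus_jacobianIdeal_subset_iff hf hkd), fun {ι _ p} hinj hp => ?_⟩
  have hpair : Pairwise fun i j => chartPoint (p j) ∉ ℂ ∙ chartPoint (p i) := fun i j hij h =>
    hij (hinj (eq_of_chartPoint_mem_span h))
  have hzero : ∀ v ∈ zeroLocus ℂ (jacobianIdeal k f), v ≠ 0 → ∃ i, v ∈ ℂ ∙ chartPoint (p i) :=
    fun v => exists_mem_span_chartPoint hf hkd hp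
  have hl (i : ι) := isHomogeneous_X ℂ (chartIndex (p i))
  have eval_X (i : ι) : eval (chartPoint (p i)) (X (chartIndex (p i))) ≠ 0 := by
    simp [chartPoint_chartIndex]
  choose M h eval_h span_mul_le using exists_span_mul_pointIdeal_pow_le hpair hzero
  obtain ⟨N, finrank_gradedPiece, hMN⟩ :=
    ((eventually_finrank_gradedPiece_eq_sum hJ hpair hzero hl eval_X).and
      (Filter.eventually_ge_atTop (Finset.univ.sup M))).exists
  have e (i : ι) := tjurinaAlgebraEquiv hf hkd (eval_h i) <|
    (Ideal.mul_mono_right (Ideal.pow_le_pow_right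
      ((Finset.le_sup (Finset.mem_univ i)).trans hMN))).trans (span_mul_le i)
  refine ⟨fun i => ?_, ?_⟩
  · have := finite_quotient_sup_pointIdeal_pow hJ (hl i) (eval_X i) N
    exact .equiv (e i).toLinearEquiv
  · obtain ⟨m₀, hm₀⟩ := Filter.eventually_atTop.mp finrank_gradedPiece
    exact ⟨m₀, fun m hm => (hm₀ m hm).trans
      (Finset.sum_congr rfl fun i _ => (e i).toLinearEquiv.finrank_eq)⟩

theorem theorem3p2 (n d k : ℕ) (f : MvPolynomial (Fin (n + 1)) ℂ)
    (hf : f.IsHomogeneous d) (hred : Squarefree f) (hkd : k ≤ d) :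
    (IsArtinianRing (HigherMilnor.MilnorAlgebra k f) ↔
      ∀ p ∈ HigherMilnor.hypersurface f, HigherMilnor.hypersurfaceMultiplicity f p ≤ (k : ℕ∞)) ∧
    (1 ≤ k → ∀ (s : ℕ) (p : Fin s → HigherMilnor.ProjSpace n), Function.Injective p →
      Set.range p = HigherMilnor.singularLocus f →
        (∀ i, Module.Finite ℂ (HigherMilnor.TjurinaAlgebra k (HigherMilnor.localGerm f (p i)))) ∧
        ∃ m₀ : ℕ, ∀ m ≥ m₀,
          Module.finrank ℂ (HigherMilnor.milnorPiece k f m) =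
            ∑ i, HigherMilnor.tjurinaNumber k f (p i)) :=
  let ⟨hartinian, hisolated⟩ := theorem3p2_general hf hkd
  ⟨hartinian, fun hk _ _ hinj hp => hisolated hinj fun _ hq => hp ▸
    HigherMilnor.mem_singularLocus_of_lt_hypersurfaceMultiplicity hf hkd hk hq⟩
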